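/- **Setting.** Let $G$ be a finite group with identity $e$, and let $D(G)$ be its quantum double, with basis $\delta_h\otimes g$ ($h,g\in G$), product $(\delta_h\otimes g)(\delta_f\otimes k)=\delta_{h,gfg^{-1}}\,\delta_h\otimes gk$ and antipode $S(\delta_h\otimes g)=\delta_{g^{-1}h^{-1}g}\otimes g^{-1}$. Let $\Sigma$ be a finite connected oriented lattice (a cell decomposition, with a direction chosen on every edge, whose faces and vertices may have any valency) of the closed plane, i.e. of the oriented sphere. Let $\mathcal H=\bigotimes_{\text{arrows}}\mathbb C G$. A site $s=(v,p)$ is a vertex $v$ with an adjacent face $p$ and a placement (cilium) of $v$ on the boundary of $p$. The group element $h\in G$ acts at a vertex $v$ by $h\triangleright$, which multiplies an arrow leaving $v$ by $h$ from the left and an arrow entering $v$ by $h^{-1}$ from the right. The operator $\delta_f\triangleright$ at $s$ projects onto the basis states for which the ordered product of arrow values, taken clockwise around $p$ starting at $v$ (inverted for arrows traversed backwards), equals $f$. The action of $D(G)$ at $s$ is $(\delta_f\otimes g)\triangleright_s=(\delta_f\triangleright)\circ(g\triangleright)$, and we write $|\psi\rangle\triangleleft_s x:=S(x)\triangleright_s|\psi\rangle$.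 Put $A(v)=|G|^{-1}\sum_h h\triangleright$ and $B(p)=\delta_e\triangleright$. A vacuum vector is a nonzero $|{\rm vac}\rangle\in\mathcal H$ that is fixed by all $A(v)$ and $B(p)$. Let $s_0=(v_0,p_0)$ and $s_1=(v_1,p_1)$ be disjoint sites, i.e. $v_0\ne v_1$ and $p_0\neq p_1$, and let $$\mathcal L(s_0,s_1)=\{|\psi\rangle\in\mathcal H : A(v)|\psi\rangle=B(p)|\psi\rangle=|\psi\rangle\ \ \forall v\notin\{v_0,v_1\},\ p\notin\{p_0,p_1\}\}.$$ A ribbon from $s_0$ to $s_1$ is a sequence of direct triangles $\tau$ (moving the site along an arrow, clockwise around its face) and dual triangles $\tau^*$ (moving the site across an arrow, anticlockwise around its vertex). Its ribbon operators are obtained from $F_\tau^{h,g}=T_\tau^g$ (projection onto the value $g$ of the arrow along the direction of motion) and $F_{\tau^*}^{h,g}=\delta_{g,e}L^h_{\tau^*}$ (the vertex operation of $h$ on the crossed arrow only) by $F_{\xi'\circ\xi}^{h,g}=\sum_{f}F_{\xi'}^{f^{-1}hf,f^{-1}g}\circ F_\xi^{h,f}$. Let $\mathcal C\subseteq G$ be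 a conjugacy class, $r\in\mathcal C$, $C_G$ the centraliser of $r$, $q:\mathcal C\to G$ a map with $q_c r q_c^{-1}=c$, and $\pi$ a finite-dimensional irreducible complex representation of $C_G$ on $V_\pi$. Put $$P_{\mathcal C,\pi}=\frac{\dim V_\pi}{|C_G|}\sum_{c\in\mathcal C}\sum_{n\in C_G}\mathrm{Tr}_\pi(n^{-1})\,\delta_c\otimes q_c n q_c^{-1}\in D(G).$$ **Claim.** For every such $(\mathcal C,\pi)$: 1. For every $|\psi\rangle\in\mathcal L(s_0,s_1)$, $$P_{\mathcal C,\pi}\triangleright_{s_0}|\psi\rangle=|\psi\rangle\triangleleft_{s_1}P_{\mathcal C,\pi};$$ in particular a quasiparticle of type $(\mathcal C,\pi)$ is detected at $s_0$ (the left-hand side is nonzero) if and only if it is detected at $s_1$ (the right-hand side is nonzero). 2. For every vacuum vector $|{\rm vac}\rangle$ and every ribbon $\xi$ from $s_0$ to $s_1$, the state $$|\mathrm{Bell},\xi\rangle=\sum_{h\in G}F_\xi^{h,e}|{\rm vac}\rangle$$ lies in $\mathcal L(s_0,s_1)$ and satisfies $$P_{\mathcal C,\pi}\triangleright_{s_0}|\mathrm{Bell},\xi\rangle=|\mathrm{Bell},\xi\rangle\triangleleft_{s_1}P_{\mathcal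 C,\pi}\neq0.$$ -/

import Mathlib

noncomputable section

namespace Kitaev

open scoped Classical

/-! ### Oriented cell decompositions of closed surfaces -/

/-- A finite oriented cell decomposition of a closed oriented surface, presented by its darts
(half-edges). A dart `d` is an edge together with the choice of one of its ends as tail;
`opp d` is the same edge with the other end as tail, `rot d` is the next dart anticlockwise around
the tail of `d`. `IsArrow` selects one of the two darts of every edge: the edge, directed
from the tail of that dart to its other end, is the arrow of the lattice. -/
structure SurfaceMap (D : Type*) where
  rot : Equiv.Perm D
  opp : Equiv.Perm D
  opp_opp : ∀ d, opp (opp d) = d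
  IsArrow : D → Prop
  isArrow_opp : ∀ d, IsArrow (opp d) ↔ ¬ IsArrow d

namespace SurfaceMap

variable {D : Type*} (M : SurfaceMap D)

/-- The next dart clockwise around the face on the right-hand side of a dart. -/
def next : Equiv.Perm D := M.rot * M.opp

/-- Vertices: cycles (fixed points included) of the anticlockwise rotation. -/
abbrev Vertex : Type _ := Quotient (Equiv.Perm.SameCycle.setoid M.rot)

/-- Faces: cycles (fixed points included) of the clockwise walk around a face. -/
abbrev Face : Type _ := Quotient (Equiv.Perm.SameCycle.setoid M.next)

/-- Arrows: the edges, each with its chosen direction. -/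
abbrev Arrow : Type _ := {d : D // M.IsArrow d}

/-- A site is a vertex `v`, an adjacent face `p`, and the placement of `v` on the boundary of `p`
(the cilium), that is, a corner at `v`. A corner is recorded by the first dart that one meets when
turning anticlockwise around `v` from the cilium. This dart is also the first one on the
clockwise walk around `p` that starts at `v`. -/
abbrev Site (_M : SurfaceMap D) : Type _ := D

/-- The tail of a dart, which is the vertex of the corresponding site. -/
def vertex (s : M.Site) : M.Vertex := Quotient.mk _ s

/-- The face to the right of a dart, which is the face of the corresponding site. -/
def face (s : M.Site) : M.Face := Quotient.mk _ s

/-- The surface is a sphere (a closed plane): the decomposition is connected and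
`V - E + F = 2`. -/
def IsSphere : Prop :=
  (∀ d d' : D, ∃ w ∈ Subgroup.closure ({M.rot, M.opp} : Set (Equiv.Perm D)), w d = d') ∧
    Nat.card M.Vertex + Nat.card M.Face = Nat.card M.Arrow + 2

/-- Disjoint sites share neither the vertex nor the face. -/
def DisjointSites (s t : M.Site) : Prop := M.vertex s ≠ M.vertex t ∧ M.face s ≠ M.face t

/-! ### Ribbons -/

/-- A triangle leads from a site to an adjacent one: a direct triangle moves along the edge of the
dart `s` and keeps the face, clockwise; a dual triangle crosses the edge of the dart `s` and keeps
the vertex, anticlockwise. -/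
inductive Triangle : M.Site → M.Site → Type _
  | direct (s : M.Site) : Triangle s (M.next s)
  | dual (s : M.Site) : Triangle s (M.rot s)

/-- A ribbon from a site to a site, as a sequence of triangles. -/
inductive Ribbon : M.Site → M.Site → Type _
  | nil (s : M.Site) : Ribbon s s
  | snoc {s t u : M.Site} (ξ : Ribbon s t) (τ : M.Triangle t u) : Ribbon s u

/-! ### The Hilbert space -/

variable (G : Type*)

/-- A group element on every arrow: the labels of the standard basis of the Hilbert space. -/
abbrev Config : Type _ := M.Arrow → G

/-- The tensor product over all arrows of the spaces `ℂ G`, with orthonormal basis the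
configurations. -/
abbrev State : Type _ := EuclideanSpace ℂ (M.Config G)

variable {M G}

/-- The basis state of a configuration. -/
def ket (U : M.Config G) : M.State G := EuclideanSpace.single U 1

variable [Fintype D] [Fintype G]

/-- The linear operator with prescribed values on the basis states. -/
def opOfKets (T : M.Config G → M.State G) : M.State G →ₗ[ℂ] M.State G :=
  ∑ U : M.Config G, ((EuclideanSpace.proj U : M.State G →L[ℂ] ℂ) : M.State G →ₗ[ℂ] ℂ).smulRight (T U)

variable [Group G]

/-! ### Vertex and face operators -/

/-- The group element of a dart: the one of the arrow, or its inverse against the arrow. -/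
def val (U : M.Config G) (d : D) : G :=
  if h : M.IsArrow d then U ⟨d, h⟩
  else (U ⟨M.opp d, (M.isArrow_opp d).mpr h⟩)⁻¹

/-- The ordered product of the group elements met on the clockwise walk around the face
of the site, starting at its vertex. -/
def holonomy (s : M.Site) (U : M.Config G) : G :=
  ((List.range (Function.minimalPeriod M.next s)).map fun i => val U (M.next^[i] s)).prod

/-- The effect of `h` at the vertex `v`: an arrow that leaves `v` is multiplied by `h` from the
left, an arrow that enters `v` by `h⁻¹` from the right. -/
def gauge (v : M.Vertex) (h : G) (U : M.Config G) : M.Config G := fun a =>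
  (if M.vertex a.1 = v then h else 1) * U a * (if M.vertex (M.opp a.1) = v then h⁻¹ else 1)

/-- The operator `h ▹` at the vertex `v`. -/
def vertexOp (v : M.Vertex) (h : G) : M.State G →ₗ[ℂ] M.State G :=
  opOfKets fun U => ket (gauge v h U)

/-- The operator `δ_f ▹` at the site `s`. -/
def faceOp (s : M.Site) (f : G) : M.State G →ₗ[ℂ] M.State G :=
  opOfKets fun U => if holonomy s U = f then ket U else 0

/-- `A(v)`, the action of the normalised integral of `ℂ G`. -/
def vertexProj (v : M.Vertex) : M.State G →ₗ[ℂ] M.State G :=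
  (Fintype.card G : ℂ)⁻¹ • ∑ h : G, vertexOp v h

/-- `B(p) = δ_e ▹`, computed at a site `s` of the face `p`. It does not depend on the placement
of `s` on the boundary of `p`. -/
def faceProj (s : M.Site) : M.State G →ₗ[ℂ] M.State G := faceOp s 1

variable (M G) in
/-- The space of vacuum states. -/
def vacuumSpace : Submodule ℂ (M.State G) where
  carrier := {ψ | (∀ v : M.Vertex, vertexProj v ψ = ψ) ∧ ∀ s : M.Site, faceProj s ψ = ψ}
  add_mem' ha hb := ⟨fun v => by rw [map_add, ha.1 v, hb.1 v], fun s => by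
    rw [map_add, ha.2 s, hb.2 s]⟩
  zero_mem' := ⟨fun v => map_zero _, fun s => map_zero _⟩
  smul_mem' c ψ h := ⟨fun v => by rw [map_smul, h.1 v], fun s => by rw [map_smul, h.2 s]⟩

variable (G) in
/-- `𝓛(s₀, s₁)`: the states that are vacuum at every vertex and every face other than the vertices
and the faces of the sites `s₀` and `s₁`. -/
def ribbonSpace (s₀ s₁ : M.Site) : Submodule ℂ (M.State G) where
  carrier := {ψ |
    (∀ v : M.Vertex, v ≠ M.vertex s₀ → v ≠ M.vertex s₁ → vertexProj v ψ = ψ) ∧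
    ∀ s : M.Site, M.face s ≠ M.face s₀ → M.face s ≠ M.face s₁ → faceProj s ψ = ψ}
  add_mem' ha hb := ⟨fun v h h' => by rw [map_add, ha.1 v h h', hb.1 v h h'], fun s h h' => by
    rw [map_add, ha.2 s h h', hb.2 s h h']⟩
  zero_mem' := ⟨fun v _ _ => map_zero _, fun s _ _ => map_zero _⟩
  smul_mem' c ψ k := ⟨fun v h h' => by rw [map_smul, k.1 v h h'], fun s h h' => by
    rw [map_smul, k.2 s h h']⟩

/-! ### Ribbon operators -/

/-- The vertex operation of `h` at the tail of the dart `d`, restricted to the edge of `d`. -/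
def edgeMul (d : D) (h : G) (U : M.Config G) : M.Config G := fun a =>
  if a.1 = d then h * U a else if a.1 = M.opp d then U a * h⁻¹ else U a

/-- The operator `T^g` of the direct triangle along the dart `d`. -/
def directOp (d : D) (g : G) : M.State G →ₗ[ℂ] M.State G :=
  opOfKets fun U => if val U d = g then ket U else 0

/-- The operator `L^h` of the dual triangle across the dart `d`. -/
def dualOp (d : D) (h : G) : M.State G →ₗ[ℂ] M.State G :=
  opOfKets fun U => ket (edgeMul d h U)

/-- Triangles as elementary ribbons: `F^{h,g} = T^g` for a direct triangle and
`F^{h,g} = δ_{g,e} L^h` for a dual triangle. -/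
def Triangle.op : {s t : M.Site} → M.Triangle s t → G → G → (M.State G →ₗ[ℂ] M.State G)
  | _, _, .direct s, _, g => directOp s g
  | _, _, .dual s, h, g => if g = 1 then dualOp s h else 0

/-- The ribbon operator `F_ξ^{h,g}`, the convolution
`F_{τ∘ξ}^{h,g} = ∑_f F_τ^{f⁻¹hf, f⁻¹g} ∘ F_ξ^{h,f}` of its triangle operators. -/
def Ribbon.op : {s t : M.Site} → M.Ribbon s t → G → G → (M.State G →ₗ[ℂ] M.State G)
  | _, _, .nil _, _, g => if g = 1 then LinearMap.id else 0
  | _, _, .snoc ξ τ, h, g => ∑ f : G, (τ.op (f⁻¹ * h * f) (f⁻¹ * g)) ∘ₗ (ξ.op h f)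

/-- The state `∑_h F_ξ^{h,e} |vac⟩`. -/
def bellState {s t : M.Site} (ξ : M.Ribbon s t) (vac : M.State G) : M.State G :=
  ∑ h : G, ξ.op h 1 vac

end SurfaceMap

/-! ### The quantum double `D(G)` and its site actions -/

/-- The vector space of `D(G) = ℂ(G) ⊗ ℂ G`; the pair `(h, g)` is the basis vector `δ_h ⊗ g`. -/
abbrev QuantumDouble (G : Type*) : Type _ := G × G →₀ ℂ

namespace QuantumDouble

variable {G : Type*} [Group G]

/-- The antipode `S(δ_h ⊗ g) = δ_{g⁻¹ h⁻¹ g} ⊗ g⁻¹`. -/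
def antipode : QuantumDouble G →ₗ[ℂ] QuantumDouble G :=
  Finsupp.linearCombination ℂ fun x => Finsupp.single (x.2⁻¹ * x.1⁻¹ * x.2, x.2⁻¹) 1

variable [Fintype G]

/-- The element `P_{C,π}`, for a conjugacy class `C`, an element `r` of `C`, a map `q` with
`q_c r q_c⁻¹ = c`, and a representation `π` of the centraliser of `r`. -/
def proj (C : ConjClasses G) (r : G) (q : C.carrier → G) {V : Type*} [AddCommGroup V]
    [Module ℂ V] (π : Representation ℂ (Subgroup.centralizer {r}) V) : QuantumDouble G :=
  ((Module.finrank ℂ V : ℂ) / Nat.card (Subgroup.centralizer {r})) •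
    ∑ c : C.carrier, ∑ n : Subgroup.centralizer {r},
      Finsupp.single ((c : G), q c * n * (q c)⁻¹) (LinearMap.trace ℂ V (π n⁻¹))

variable {D : Type*} [Fintype D] {M : SurfaceMap D}

/-- The left action `▹_s` of `D(G)` at a site, `(δ_f ⊗ g) ▹_s = (δ_f ▹_s) ∘ (g ▹_s)`. -/
def leftAct (s : M.Site) : QuantumDouble G →ₗ[ℂ] (M.State G →ₗ[ℂ] M.State G) :=
  Finsupp.linearCombination ℂ fun x =>
    SurfaceMap.faceOp s x.1 ∘ₗ SurfaceMap.vertexOp (M.vertex s) x.2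

/-- The right action `◃_s` of `D(G)` at a site, `ψ ◃_s x = S(x) ▹_s ψ`. -/
def rightAct (s : M.Site) (ψ : M.State G) (x : QuantumDouble G) : M.State G :=
  leftAct s (antipode x) ψ

end QuantumDouble

end Kitaev

end

noncomputable section

namespace Kitaev

open scoped Classical

/-! ### Rooted spanning trees -/

/-! In coordinates, `leftAct_apply` and `rightAct_proj_apply` present the two charge measurements of
a state `ψ` at a configuration `W` as sums over `x : G`. At `s₀` the summand is the coefficient of
the projector at `(h₀, x)` times `ψ` at `W` transformed by `x⁻¹` at the first vertex; at `s₁` it is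
the coefficient at `(h₁⁻¹, x)` times `ψ` at `W` transformed by `x` at the second vertex. Here `h₀`,
`h₁` are the holonomies of `W`. The coefficients are supported on commuting pairs and invariant
under simultaneous conjugation (`commute_of_proj_ne_zero`, `proj_conj`).

Both sums vanish unless `W` is flat off the two faces. For such `W` the topology of the sphere
enters: the edges split into a spanning tree of the vertices and one of the faces
(`IsSphere.exists_tree_cotree`). Gauging the first tree to 1 and solving the flatness equations
along the second, from the leaves inwards, leaves only powers of `h₀` on the edges
(`IsSphere.exists_gauge_mem_zpowers`). In this abelian gauge the face products multiply to 1, so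
`h₁` is conjugate to `h₀⁻¹` (`loopProd_eq_conj_inv`). Moreover a constant `x` commuting with `h₀`
stabilises the connection. Since `ψ` is gauge invariant at all other vertices, acting by `x⁻¹` at
the first vertex amounts to acting by a conjugate of `x` at the second
(`apply_gauge_eq_apply_gauge`), and the two sums agree term by term.

For the Bell states, a flat configuration is pure gauge, and a ribbon operator with parameter `h`
multiplies its edges, in that gauge, by powers of `h` counting signed crossings
(`Ribbon.move_of_pure_gauge`). These counts sum to zero around every face other than the end faces,
whatever the self-crossings of the ribbon. Nonvanishing is read off at one configuration with
holonomy `r` at `s₀`, where only the summand `x = 1` survives (`IsSphere.exists_bellState_ne_zero`).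
-/

/-- If a root is contained in no proper set closed under going back along the admissible edges,
then there are a rank function and a choice of parent edges that lead to the root. -/
theorem exists_rank_parent {X E : Type*} [Nonempty E] (src tgt : E → X) (ok : E → Prop) (x₀ : X)
    (h : ∀ A : Set X, x₀ ∈ A → (∀ e, ok e → tgt e ∈ A → src e ∈ A) → ∀ x, x ∈ A) :
    ∃ (rank : X → ℕ) (par : X → E), ∀ x, x ≠ x₀ →
      ok (par x) ∧ src (par x) = x ∧ rank (tgt (par x)) < rank x := by
  -- `R n x` says that some path of `n` admissible edges leads from `x` to the root; the rank is the
  -- least such `n`.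
  let R : ℕ → X → Prop := fun n => Nat.rec (motive := fun _ => X → Prop) (fun x => x = x₀)
    (fun _ P x => ∃ e, ok e ∧ src e = x ∧ P (tgt e)) n
  have hR : ∀ x, ∃ n, R n x := by
    refine h {x | ∃ n, R n x} ⟨0, rfl⟩ ?_
    rintro e he ⟨n, hn⟩
    exact ⟨n + 1, e, he, rfl, hn⟩
  have key : ∀ x, ∃ e, x ≠ x₀ → ok e ∧ src e = x ∧ Nat.find (hR (tgt e)) < Nat.find (hR x) := by
    intro x
    by_cases hx : x = x₀
    · exact ⟨Classical.arbitrary E, fun h => absurd hx h⟩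
    · have hs := Nat.find_spec (hR x)
      cases hn : Nat.find (hR x) with
      | zero => rw [hn] at hs; exact absurd hs hx
      | succ n =>
        rw [hn] at hs
        obtain ⟨e, he, rfl, h3⟩ := hs
        exact ⟨e, fun _ => ⟨he, rfl, Nat.lt_succ_of_le (Nat.find_min' _ h3)⟩⟩
  choose par hpar using key
  exact ⟨fun x => Nat.find (hR x), par, hpar⟩

/-- A group valued function on the edges is trivialised along a rooted tree by a function on the
vertices. -/
theorem exists_potential {X E G : Type*} [Group G] (tgt : E → X) (w : E → G) (x₀ : X)
    (rank : X → ℕ) (par : X → E) (h : ∀ x, x ≠ x₀ → rank (tgt (par x)) < rank x) :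
    ∃ φ : X → G, φ x₀ = 1 ∧ ∀ x, x ≠ x₀ → φ x * w (par x) * (φ (tgt (par x)))⁻¹ = 1 := by
  let F : ∀ x, (∀ y, (measure rank).rel y x → G) → G := fun x rec =>
    if hx : x = x₀ then 1 else rec (tgt (par x)) (h x hx) * (w (par x))⁻¹
  refine ⟨(measure rank).wf.fix F, ?_, fun x hx => ?_⟩
  · rw [WellFounded.fix_eq]
    simp [F]
  · rw [WellFounded.fix_eq]
    simp [F, hx]

namespace SurfaceMap

variable {D : Type*} (M : SurfaceMap D)

/-! ### Combinatorics of the darts -/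

theorem vertex_rot (d : D) : M.vertex (M.rot d) = M.vertex d :=
  Quotient.sound (Equiv.Perm.sameCycle_apply_left.mpr (Equiv.Perm.SameCycle.refl _ _))

theorem face_next (d : D) : M.face (M.next d) = M.face d :=
  Quotient.sound (Equiv.Perm.sameCycle_apply_left.mpr (Equiv.Perm.SameCycle.refl _ _))

theorem next_apply (d : D) : M.next d = M.rot (M.opp d) := rfl

theorem vertex_next (d : D) : M.vertex (M.next d) = M.vertex (M.opp d) := M.vertex_rot _

theorem face_rot (d : D) : M.face (M.rot d) = M.face (M.opp d) := by
  rw [← M.face_next (M.opp d), next_apply, M.opp_opp]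

theorem opp_ne (d : D) : M.opp d ≠ d := by
  intro h
  have := M.isArrow_opp d
  rw [h] at this
  tauto

variable {M} in
theorem vertex_eq_iff {d e : D} : M.vertex d = M.vertex e ↔ M.rot.SameCycle d e :=
  Quotient.eq

variable {M} in
theorem face_eq_iff {d e : D} : M.face d = M.face e ↔ M.next.SameCycle d e :=
  Quotient.eq

variable {M}

/-- A property of darts that is invariant under the rotation and the inversion holds for all darts
of a connected map if it holds for one. -/
theorem IsSphere.forall_dart (hM : M.IsSphere) (Q : D → Prop) (hrot : ∀ d, Q (M.rot d) ↔ Q d)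
    (hopp : ∀ d, Q (M.opp d) ↔ Q d) {s : D} (hs : Q s) (d : D) : Q d := by
  obtain ⟨w, hw, rfl⟩ := hM.1 s d
  have key : ∀ e, Q (w e) ↔ Q e := by
    induction hw using Subgroup.closure_induction with
    | mem x hx =>
      rcases hx with rfl | rfl
      · exact hrot
      · exact hopp
    | one => exact fun e => Iff.rfl
    | mul x y _ _ hx hy => exact fun e => (hx (y e)).trans (hy e)
    | inv x _ hx => exact fun e => by rw [← hx, ← Equiv.Perm.mul_apply, mul_inv_cancel, Equiv.Perm.one_apply]
  exact (key s).mpr hs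

/-- A predicate that changes at most once on a cycle of a permutation does not change. -/
theorem rot_iff_of_unique_change [Finite D] (a : D → Prop) (d₀ : D)
    (h : ∀ d, M.vertex d = M.vertex d₀ → d ≠ d₀ → (a (M.rot d) ↔ a d)) :
    a (M.rot d₀) ↔ a d₀ := by
  have key : ∀ i : ℕ, a ((M.rot ^ i) (M.rot d₀)) ↔ a (M.rot d₀) := by
    intro i
    induction i with
    | zero => rfl
    | succ i ih =>
      rw [pow_succ', Equiv.Perm.mul_apply]
      by_cases hd : (M.rot ^ i) (M.rot d₀) = d₀
      · rw [hd]
      · refine (h _ ?_ hd).trans ih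
        rw [vertex_eq_iff]
        simp [Equiv.Perm.SameCycle.refl]
  have hc : M.rot.SameCycle (M.rot d₀) d₀ :=
    Equiv.Perm.sameCycle_apply_left.mpr (Equiv.Perm.SameCycle.refl _ _)
  obtain ⟨i, hi⟩ := hc.exists_nat_pow_eq
  rw [← key i, hi]

variable (M) in
/-- The arrow of the edge of a dart. -/
def edge (d : D) : M.Arrow :=
  if h : M.IsArrow d then ⟨d, h⟩ else ⟨M.opp d, (M.isArrow_opp d).mpr h⟩

theorem eq_or_eq_opp_of_edge_eq {d e : D} (h : M.edge d = M.edge e) : d = e ∨ d = M.opp e := by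
  unfold edge at h
  split_ifs at h with h1 h2 h2 <;> simp only [Subtype.mk.injEq] at h
  · exact Or.inl h
  · exact Or.inr h
  · exact Or.inr (by rw [← h, M.opp_opp])
  · exact Or.inl (M.opp.injective h)

/-! ### Tree and cotree on the sphere -/

/-- A spanning tree of the vertices, rooted at `v₀`. -/
theorem IsSphere.exists_tree (hM : M.IsSphere) [Nonempty D] (v₀ : M.Vertex) :
    ∃ (rk : M.Vertex → ℕ) (par : M.Vertex → D), ∀ v, v ≠ v₀ →
      M.vertex (par v) = v ∧ rk (M.vertex (M.opp (par v))) < rk v := by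
  obtain ⟨rk, par, h⟩ := exists_rank_parent (E := D) M.vertex (fun d => M.vertex (M.opp d))
    (fun _ => True) v₀ (by
      intro A h0 hA v
      induction v₀ using Quotient.inductionOn with | _ s =>
      induction v using Quotient.inductionOn with | _ d =>
      refine hM.forall_dart (fun d => M.vertex d ∈ A) (fun d => by rw [vertex_rot])
        (fun d => ⟨fun h => hA d trivial h, fun h => hA (M.opp d) trivial ?_⟩) h0 d
      rwa [M.opp_opp])
  exact ⟨rk, par, fun v hv => (h v hv).2⟩

/-- The complement of a spanning tree of the vertices connects the faces. -/
theorem IsSphere.exists_cotree [Finite D] [Nonempty D] (hM : M.IsSphere) {v₀ : M.Vertex}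
    {rk : M.Vertex → ℕ} {par : M.Vertex → D}
    (h : ∀ v, v ≠ v₀ → M.vertex (par v) = v ∧ rk (M.vertex (M.opp (par v))) < rk v)
    (p : M.Face) :
    ∃ (drk : M.Face → ℕ) (dpar : M.Face → D), ∀ f, f ≠ p →
      (¬ ∃ v, v ≠ v₀ ∧ (dpar f = par v ∨ dpar f = M.opp (par v))) ∧
      M.face (dpar f) = f ∧ drk (M.face (M.opp (dpar f))) < drk f := by
  refine exists_rank_parent (E := D) M.face (fun d => M.face (M.opp d))
    (fun d => ¬ ∃ v, v ≠ v₀ ∧ (d = par v ∨ d = M.opp (par v))) p ?_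
  intro A h0 hA f
  have hno : ∀ d, (¬ ∃ v, v ≠ v₀ ∧ (d = par v ∨ d = M.opp (par v))) →
      (M.face (M.opp d) ∈ A ↔ M.face d ∈ A) := by
    refine fun d hd => ⟨hA d hd, fun hd' => hA (M.opp d) ?_ (by rwa [M.opp_opp])⟩
    rintro ⟨v, hv, hv'⟩
    refine hd ⟨v, hv, ?_⟩
    rcases hv' with hv' | hv'
    · exact Or.inr (by rw [← hv', M.opp_opp])
    · exact Or.inl (M.opp.injective hv')
  -- If tree edges separate `A` from its complement, take such an edge `par v` with `v` of maximal
  -- rank. The other tree edges at `v` come from vertices of larger rank, so around `v` membership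
  -- in `A` could change only across `par v`; a single change around a cycle is impossible.
  have htree : ∀ v, v ≠ v₀ → (M.face (M.opp (par v)) ∈ A ↔ M.face (par v) ∈ A) := by
    by_contra! hcon
    obtain ⟨v, ⟨hv, hvA⟩, hmax⟩ := Set.exists_max_image
      {v | v ≠ v₀ ∧ ¬ (M.face (M.opp (par v)) ∈ A ↔ M.face (par v) ∈ A)} rk
      (Set.toFinite _) (by
        obtain ⟨v, hv, hv'⟩ := hcon
        exact ⟨v, hv, by tauto⟩)
    refine hvA ?_
    rw [← face_rot]
    refine rot_iff_of_unique_change (M := M) (fun d => M.face d ∈ A) (par v) fun d hd hne => ?_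
    rw [face_rot]
    by_cases hT : ∃ u, u ≠ v₀ ∧ (d = par u ∨ d = M.opp (par u))
    · obtain ⟨u, hu, rfl | rfl⟩ := hT
      · rw [(h u hu).1, (h v hv).1] at hd
        exact absurd (by rw [hd]) hne
      · by_contra hc
        rw [M.opp_opp] at hc
        have h1 := hmax u ⟨hu, by tauto⟩
        have h2 := (h u hu).2
        rw [hd, (h v hv).1] at h2
        omega
    · exact hno d hT
  induction f using Quotient.inductionOn with | _ d =>
  induction p using Quotient.inductionOn with | _ s =>
  have hopp : ∀ d, M.face (M.opp d) ∈ A ↔ M.face d ∈ A := by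
    intro d
    by_cases hT : ∃ u, u ≠ v₀ ∧ (d = par u ∨ d = M.opp (par u))
    · obtain ⟨u, hu, rfl | rfl⟩ := hT
      · exact htree u hu
      · rw [M.opp_opp]
        exact (htree u hu).symm
    · exact hno d hT
  exact hM.forall_dart (fun d => M.face d ∈ A) (fun d => by rw [face_rot, hopp]) hopp h0 d

/-- On a sphere the edges are exhausted by a spanning tree of the vertices and a spanning tree of
the faces. -/
theorem IsSphere.exists_tree_cotree [Finite D] [Nonempty D] (hM : M.IsSphere) (v₀ : M.Vertex)
    (p : M.Face) :
    ∃ (rk : M.Vertex → ℕ) (par : M.Vertex → D) (drk : M.Face → ℕ) (dpar : M.Face → D),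
      (∀ v, v ≠ v₀ → M.vertex (par v) = v ∧ rk (M.vertex (M.opp (par v))) < rk v) ∧
      (∀ f, f ≠ p → M.face (dpar f) = f ∧ drk (M.face (M.opp (dpar f))) < drk f) ∧
      ∀ d, (∃ v, v ≠ v₀ ∧ (d = par v ∨ d = M.opp (par v))) ∨
        ∃ f, f ≠ p ∧ (d = dpar f ∨ d = M.opp (dpar f)) := by
  obtain ⟨rk, par, h⟩ := hM.exists_tree v₀
  obtain ⟨drk, dpar, h'⟩ := hM.exists_cotree h p
  refine ⟨rk, par, drk, dpar, h, fun f hf => (h' f hf).2, fun d => ?_⟩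
  let Φ : {v // v ≠ v₀} ⊕ {f // f ≠ p} → M.Arrow :=
    Sum.elim (fun v => M.edge (par v)) fun f => M.edge (dpar f)
  have hinj : Function.Injective Φ := by
    rintro (⟨v, hv⟩ | ⟨f, hf⟩) (⟨u, hu⟩ | ⟨g, hg⟩) he
    · rcases eq_or_eq_opp_of_edge_eq he with he | he
      · have := (h v hv).1
        simp only at he
        rw [he, (h u hu).1] at this
        simp [this]
      · simp only at he
        have h1 := (h v hv).2
        have h2 := (h u hu).2
        rw [he, M.opp_opp, (h u hu).1] at h1
        rw [← he, (h v hv).1] at h2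
        omega
    · refine absurd ⟨v, hv, ?_⟩ (h' g hg).1
      rcases eq_or_eq_opp_of_edge_eq he with he | he
      · exact Or.inl he.symm
      · simp only at he
        exact Or.inr (by rw [he, M.opp_opp])
    · exact absurd ⟨u, hu, eq_or_eq_opp_of_edge_eq he⟩ (h' f hf).1
    · rcases eq_or_eq_opp_of_edge_eq he with he | he
      · have := (h' f hf).2.1
        simp only at he
        rw [he, (h' g hg).2.1] at this
        simp [this]
      · simp only at he
        have h1 := (h' f hf).2.2
        have h2 := (h' g hg).2.2
        rw [he, M.opp_opp, (h' g hg).2.1] at h1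
        rw [← he, (h' f hf).2.1] at h2
        omega
  have hbij : Function.Bijective Φ := by
    refine (Nat.bijective_iff_injective_and_card Φ).mpr ⟨hinj, ?_⟩
    -- Tree and cotree have `V - 1` and `F - 1` edges; by Euler's formula these add up to the number
    -- of all edges.
    have e1 : Nat.card M.Vertex = Nat.card {v // v ≠ v₀} + 1 := by
      rw [← Finite.card_option]
      exact Nat.card_congr (Equiv.optionSubtypeNe v₀).symm
    have e2 : Nat.card M.Face = Nat.card {f // f ≠ p} + 1 := by
      rw [← Finite.card_option]
      exact Nat.card_congr (Equiv.optionSubtypeNe p).symm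
    have := hM.2
    rw [Nat.card_sum]
    omega
  obtain ⟨x, hx⟩ := hbij.2 (M.edge d)
  rcases x with ⟨v, hv⟩ | ⟨f, hf⟩
  · exact Or.inl ⟨v, hv, eq_or_eq_opp_of_edge_eq hx.symm⟩
  · exact Or.inr ⟨f, hf, eq_or_eq_opp_of_edge_eq hx.symm⟩

end SurfaceMap

namespace SurfaceMap

variable {D : Type*} {M : SurfaceMap D}

/-! ### Products around faces -/

/-- The darts met on the clockwise walk around the face of a site. -/
def faceList (s : M.Site) : List D :=
  (List.range (Function.minimalPeriod M.next s)).map fun i => M.next^[i] s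

variable (M) in
/-- The ordered product of a function on the darts around the face of a site. -/
def loopProd {A : Type*} [Monoid A] (w : D → A) (s : M.Site) : A :=
  ((List.range (Function.minimalPeriod M.next s)).map fun i => w (M.next^[i] s)).prod

theorem loopProd_eq_faceList {A : Type*} [Monoid A] (w : D → A) (s : M.Site) :
    M.loopProd w s = ((faceList s).map w).prod := by
  rw [loopProd, faceList, List.map_map]
  rfl

theorem nodup_faceList (s : M.Site) : (faceList s).Nodup :=
  Function.nodup_periodicOrbit (f := M.next) (x := s)

theorem mem_faceList [Finite D] {s : M.Site} {d : D} :
    d ∈ faceList s ↔ M.face d = M.face s := by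
  rw [face_eq_iff, Equiv.Perm.sameCycle_comm]
  have hs : s ∈ Function.periodicPts M.next :=
    M.next.injective.mem_periodicPts s
  refine (Function.mem_periodicOrbit_iff (f := M.next) (x := s) hs).trans ⟨?_, fun h => ?_⟩
  · rintro ⟨n, rfl⟩
    rw [Equiv.Perm.iterate_eq_pow]
    exact ⟨n, by simp⟩
  · obtain ⟨n, hn⟩ := h.exists_nat_pow_eq
    exact ⟨n, by rw [Equiv.Perm.iterate_eq_pow, hn]⟩

/-- The head of each dart is the tail of the next, so the inner factors of `φ` cancel; after a full
period the walk is back at `s`. -/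
theorem loopProd_conj {A : Type*} [Group A] (w : D → A) (φ : M.Vertex → A) (s : M.Site) :
    M.loopProd (fun d => φ (M.vertex d) * w d * (φ (M.vertex (M.opp d)))⁻¹) s =
      φ (M.vertex s) * M.loopProd w s * (φ (M.vertex s))⁻¹ := by
  have key : ∀ n : ℕ, ((List.range n).map fun i =>
      φ (M.vertex (M.next^[i] s)) * w (M.next^[i] s) *
        (φ (M.vertex (M.opp (M.next^[i] s))))⁻¹).prod =
      φ (M.vertex s) * ((List.range n).map fun i => w (M.next^[i] s)).prod *
        (φ (M.vertex (M.next^[n] s)))⁻¹ := by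
    intro n
    induction n with
    | zero => simp
    | succ n ih =>
      rw [List.range_succ, List.map_append, List.prod_append, ih, List.map_append,
        List.prod_append, Function.iterate_succ_apply', vertex_next]
      simp [mul_assoc]
  rw [loopProd, key, Function.iterate_minimalPeriod, loopProd]

theorem map_loopProd {A B : Type*} [Monoid A] [Monoid B] (θ : A →* B) (w : D → A) (s : M.Site) :
    θ (M.loopProd w s) = M.loopProd (fun d => θ (w d)) s := by
  rw [loopProd_eq_faceList, loopProd_eq_faceList, map_list_prod, List.map_map]
  rfl

theorem loopProd_eq_prod [Fintype D] {A : Type*} [CommMonoid A] (w : D → A) (s : M.Site) :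
    M.loopProd w s = ∏ d with M.face d = M.face s, w d := by
  rw [loopProd_eq_faceList, ← List.prod_toFinset _ (nodup_faceList s)]
  refine Finset.prod_congr ?_ fun _ _ => rfl
  ext d
  simp [mem_faceList]

/-- If a product around a face and all but one of its factors lie in a subgroup, so does the last
factor. -/
theorem mem_of_loopProd_mem [Finite D] {A : Type*} [Group A] {H : Subgroup A} {w : D → A}
    {s : M.Site} {d : D} (hd : M.face d = M.face s) (hs : M.loopProd w s ∈ H)
    (h : ∀ e, M.face e = M.face d → e ≠ d → w e ∈ H) : w d ∈ H := by
  rw [loopProd_eq_faceList] at hs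
  have hn := nodup_faceList s
  obtain ⟨l₁, l₂, hl⟩ := List.append_of_mem (mem_faceList.mpr hd)
  have hmem : ∀ e ∈ faceList s, e ≠ d → w e ∈ H := fun e he =>
    h e ((mem_faceList.mp he).trans hd.symm)
  rw [hl] at hn hs hmem
  rw [List.nodup_middle, List.nodup_cons, List.mem_append, not_or] at hn
  have h₁ : (l₁.map w).prod ∈ H := H.list_prod_mem (by
    simp only [List.mem_map]
    rintro _ ⟨e, he, rfl⟩
    exact hmem e (by simp [he]) (by rintro rfl; exact hn.1.1 he))
  have h₂ : (l₂.map w).prod ∈ H := H.list_prod_mem (by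
    simp only [List.mem_map]
    rintro _ ⟨e, he, rfl⟩
    exact hmem e (by simp [he]) (by rintro rfl; exact hn.1.2 he))
  rw [List.map_append, List.prod_append, List.map_cons, List.prod_cons,
    H.mul_mem_cancel_left h₁, H.mul_mem_cancel_right h₂] at hs
  exact hs

/-! ### Connections flat off two faces -/

/-- On a sphere, a connection that is flat off two faces is gauge equivalent to a connection with
values in the group generated by the holonomy of the first face. -/
theorem IsSphere.exists_gauge_mem_zpowers [Finite D] (hM : M.IsSphere) {G : Type*} [Group G]
    (w : D → G) (hw : ∀ d, w (M.opp d) = (w d)⁻¹) (s₀ s₁ : M.Site)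
    (hflat : ∀ s : M.Site, M.face s ≠ M.face s₀ → M.face s ≠ M.face s₁ → M.loopProd w s = 1) :
    ∃ φ : M.Vertex → G, φ (M.vertex s₀) = 1 ∧ ∀ d,
      φ (M.vertex d) * w d * (φ (M.vertex (M.opp d)))⁻¹ ∈
        Subgroup.zpowers (M.loopProd w s₀) := by
  have : Nonempty D := ⟨s₀⟩
  obtain ⟨rk, par, drk, dpar, h, h', hall⟩ :=
    hM.exists_tree_cotree (M.vertex s₀) (M.face s₁)
  obtain ⟨φ, hφ₀, hφ⟩ := exists_potential (fun d => M.vertex (M.opp d)) w (M.vertex s₀) rk par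
    fun v hv => (h v hv).2
  refine ⟨φ, hφ₀, ?_⟩
  set H := Subgroup.zpowers (M.loopProd w s₀) with hH
  set l : D → G := fun d => φ (M.vertex d) * w d * (φ (M.vertex (M.opp d)))⁻¹ with hl
  have hopp : ∀ d, l (M.opp d) = (l d)⁻¹ := fun d => by
    simp [hl, hw, M.opp_opp, mul_assoc]
  have htree : ∀ v, v ≠ M.vertex s₀ → l (par v) = 1 := fun v hv => by
    rw [← hφ v hv, hl]
    simp only
    rw [(h v hv).1]
  have hface : ∀ f, f ≠ M.face s₁ → ∃ s, M.face s = f ∧ M.loopProd l s ∈ H := by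
    intro f hf
    by_cases hf₀ : f = M.face s₀
    · refine ⟨s₀, hf₀.symm, ?_⟩
      rw [hl, loopProd_conj, hφ₀]
      simp [hH]
    · induction f using Quotient.inductionOn with | _ s =>
      refine ⟨s, rfl, ?_⟩
      rw [hl, loopProd_conj, hflat s hf₀ hf]
      simp
  -- The induction descends from the faces of highest rank. In face `f`, every dart other than `dpar
  -- f` lies on a tree edge, where `l` is 1, or on the parent edge of a face of higher rank; so the
  -- face product determines `l (dpar f)` modulo `H`.
  have hcotree : ∀ n f, f ≠ M.face s₁ →
      (∀ g, g ≠ M.face s₁ → drk g ≤ n) → ∀ k, n - drk f = k → l (dpar f) ∈ H := by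
    intro n f hf hn k
    induction k using Nat.strong_induction_on generalizing f with
    | _ k ih =>
      intro hk
      obtain ⟨s, hs, hsH⟩ := hface f hf
      refine mem_of_loopProd_mem ((h' f hf).1.trans hs.symm) hsH fun e he hne => ?_
      rcases hall e with ⟨v, hv, rfl | rfl⟩ | ⟨g, hg, rfl | rfl⟩
      · rw [htree v hv]; exact H.one_mem
      · rw [hopp, htree v hv, inv_one]; exact H.one_mem
      · rw [(h' g hg).1, (h' f hf).1] at he
        exact absurd (by rw [he]) hne
      · rw [hopp]
        have h1 := (h' g hg).2
        rw [he, (h' f hf).1] at h1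
        have h2 := hn g hg
        exact H.inv_mem (ih (n - drk g) (by omega) g hg rfl)
  obtain ⟨n, hn⟩ := (Set.finite_range drk).bddAbove
  have hn' : ∀ g, g ≠ M.face s₁ → drk g ≤ n := fun g _ => hn ⟨g, rfl⟩
  intro d
  change l d ∈ H
  rcases hall d with ⟨v, hv, rfl | rfl⟩ | ⟨g, hg, rfl | rfl⟩
  · rw [htree v hv]; exact H.one_mem
  · rw [hopp, htree v hv, inv_one]; exact H.one_mem
  · exact hcotree n g hg hn' _ rfl
  · rw [hopp]; exact H.inv_mem (hcotree n g hg hn' _ rfl)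

/-- For commuting values, the products around two faces are inverse to each other if the products
around all other faces are trivial. -/
theorem loopProd_mul_loopProd [Fintype D] {A : Type*} [CommGroup A] (w : D → A)
    (hw : ∀ d, w (M.opp d) = (w d)⁻¹) {s₀ s₁ : M.Site} (hne : M.face s₀ ≠ M.face s₁)
    (hflat : ∀ s : M.Site, M.face s ≠ M.face s₀ → M.face s ≠ M.face s₁ → M.loopProd w s = 1) :
    M.loopProd w s₀ * M.loopProd w s₁ = 1 := by
  -- The two darts of an edge cancel; grouping the same product by faces leaves only the two
  -- exceptional ones.
  have htot : ∏ d, w d = 1 :=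
    Finset.prod_involution (fun d _ => M.opp d) (fun d _ => by rw [hw, mul_inv_cancel])
      (fun d _ _ => M.opp_ne d) (fun _ _ => Finset.mem_univ _) fun d _ => M.opp_opp d
  rw [← Finset.prod_fiberwise Finset.univ M.face w,
    Finset.prod_eq_mul (M.face s₀) (M.face s₁) hne] at htot
  · rw [loopProd_eq_prod, loopProd_eq_prod, htot]
  · rintro f - ⟨h₀, h₁⟩
    induction f using Quotient.inductionOn with | _ s =>
    exact (loopProd_eq_prod w s).symm.trans (hflat s h₀ h₁)
  · simp
  · simp

open scoped IsMulCommutative in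
/-- The two holonomies of a connection flat off two faces, in the gauge of
`IsSphere.exists_gauge_mem_zpowers`. -/
theorem loopProd_eq_conj_inv [Fintype D] {G : Type*} [Group G] (w : D → G)
    (hw : ∀ d, w (M.opp d) = (w d)⁻¹) {s₀ s₁ : M.Site} (hne : M.face s₀ ≠ M.face s₁)
    (hflat : ∀ s : M.Site, M.face s ≠ M.face s₀ → M.face s ≠ M.face s₁ → M.loopProd w s = 1)
    (φ : M.Vertex → G) (hφ₀ : φ (M.vertex s₀) = 1)
    (hφ : ∀ d, φ (M.vertex d) * w d * (φ (M.vertex (M.opp d)))⁻¹ ∈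
        Subgroup.zpowers (M.loopProd w s₀)) :
    M.loopProd w s₁ = (φ (M.vertex s₁))⁻¹ * (M.loopProd w s₀)⁻¹ * φ (M.vertex s₁) := by
  -- The gauge-transformed connection, read in the cyclic group, where the commutative statement
  -- applies.
  let l : D → Subgroup.zpowers (M.loopProd w s₀) := fun d => ⟨_, hφ d⟩
  have hl : ∀ s, ((M.loopProd l s : Subgroup.zpowers (M.loopProd w s₀)) : G) =
      φ (M.vertex s) * M.loopProd w s * (φ (M.vertex s))⁻¹ := fun s => by
    rw [← loopProd_conj]
    exact map_loopProd (Subgroup.subtype _) l s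
  have key := loopProd_mul_loopProd l
    (fun d => Subtype.ext (by simp [l, hw, M.opp_opp, mul_assoc])) hne
    fun s h₀ h₁ => Subtype.ext (by rw [hl, hflat s h₀ h₁]; simp)
  have key' := congrArg (Subtype.val) key
  rw [Subgroup.coe_mul, hl, hl, hφ₀, Subgroup.coe_one] at key'
  have := eq_inv_of_mul_eq_one_right key'
  simp only [one_mul, inv_one, mul_one] at this
  rw [← this]
  group

end SurfaceMap

namespace SurfaceMap

variable {D : Type*} {M : SurfaceMap D} {G : Type*} [Group G]

/-! ### Configurations and gauge transformations -/

theorem val_arrow (U : M.Config G) (a : M.Arrow) : val U a.1 = U a := by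
  simp [val, a.2]

theorem val_opp (U : M.Config G) (d : D) : val U (M.opp d) = (val U d)⁻¹ := by
  by_cases h : M.IsArrow d
  · have h' : ¬ M.IsArrow (M.opp d) := by rw [M.isArrow_opp]; exact not_not.mpr h
    simp only [val, h, h', dif_pos, dif_neg, not_false_eq_true, M.opp_opp]
  · have h' : M.IsArrow (M.opp d) := (M.isArrow_opp d).mpr h
    simp only [val, h, h', dif_pos, dif_neg, not_false_eq_true, inv_inv]

theorem config_ext {U W : M.Config G} (h : ∀ d, val U d = val W d) : U = W :=
  funext fun a => by rw [← val_arrow U, ← val_arrow W, h]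

/-- To compare the values of two configurations it is enough to consider the arrows. -/
theorem val_eq_of_arrow {U : M.Config G} {w : D → G} (hw : ∀ d, w (M.opp d) = (w d)⁻¹)
    (h : ∀ a : M.Arrow, U a = w a.1) (d : D) : val U d = w d := by
  by_cases hd : M.IsArrow d
  · exact (val_arrow U ⟨d, hd⟩).trans (h _)
  · have hd' : M.IsArrow (M.opp d) := (M.isArrow_opp d).mpr hd
    rw [← inv_inj, ← val_opp, ← hw]
    exact (val_arrow U ⟨M.opp d, hd'⟩).trans (h _)

/-- The gauge transformation by a function on the vertices. -/
def gaugeAll (γ : M.Vertex → G) (U : M.Config G) : M.Config G := fun a =>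
  γ (M.vertex a.1) * U a * (γ (M.vertex (M.opp a.1)))⁻¹

theorem val_gaugeAll (γ : M.Vertex → G) (U : M.Config G) (d : D) :
    val (gaugeAll γ U) d = γ (M.vertex d) * val U d * (γ (M.vertex (M.opp d)))⁻¹ :=
  val_eq_of_arrow (w := fun d => γ (M.vertex d) * val U d * (γ (M.vertex (M.opp d)))⁻¹)
    (fun d => by simp [val_opp, M.opp_opp, mul_assoc]) (fun a => by rw [val_arrow]; rfl) d

theorem gaugeAll_mul (γ δ : M.Vertex → G) (U : M.Config G) :
    gaugeAll (γ * δ) U = gaugeAll γ (gaugeAll δ U) :=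
  funext fun a => by simp [gaugeAll, mul_assoc]

theorem gaugeAll_one (U : M.Config G) : gaugeAll 1 U = U :=
  funext fun a => by simp [gaugeAll]

theorem gauge_eq_gaugeAll (v : M.Vertex) (h : G) (U : M.Config G) :
    gauge v h U = gaugeAll (Pi.mulSingle v h) U := by
  funext a
  simp only [gauge, gaugeAll, Pi.mulSingle_apply]
  split_ifs <;> simp

theorem gauge_inv_gauge (v : M.Vertex) (h : G) (U : M.Config G) :
    gauge v h⁻¹ (gauge v h U) = U := by
  rw [gauge_eq_gaugeAll, gauge_eq_gaugeAll, ← gaugeAll_mul, ← Pi.mulSingle_mul, inv_mul_cancel,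
    Pi.mulSingle_one, gaugeAll_one]

theorem gauge_gauge_inv (v : M.Vertex) (h : G) (U : M.Config G) :
    gauge v h (gauge v h⁻¹ U) = U := by
  simpa using gauge_inv_gauge v h⁻¹ U

theorem holonomy_gaugeAll (s : M.Site) (γ : M.Vertex → G) (U : M.Config G) :
    holonomy s (gaugeAll γ U) = γ (M.vertex s) * holonomy s U * (γ (M.vertex s))⁻¹ := by
  refine Eq.trans ?_ (loopProd_conj (val U) γ s)
  exact congrArg (fun w => M.loopProd w s) (funext fun d => val_gaugeAll γ U d)

theorem holonomy_gauge (s : M.Site) (h : G) (U : M.Config G) :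
    holonomy s (gauge (M.vertex s) h U) = h * holonomy s U * h⁻¹ := by
  rw [gauge_eq_gaugeAll, holonomy_gaugeAll, Pi.mulSingle_eq_same]

theorem holonomy_gauge_eq_one (s : M.Site) (v : M.Vertex) (h : G) (U : M.Config G) :
    holonomy s (gauge v h U) = 1 ↔ holonomy s U = 1 := by
  rw [gauge_eq_gaugeAll, holonomy_gaugeAll, conj_eq_one_iff]

/-! ### Operators in coordinates -/

variable [Fintype D] [Fintype G]

omit [Group G] in
theorem opOfKets_apply (T : M.Config G → M.State G) (ψ : M.State G) :
    opOfKets T ψ = ∑ U, ψ U • T U := by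
  simp [opOfKets, LinearMap.sum_apply]

omit [Group G] [Fintype G] in
theorem ket_apply (U W : M.Config G) : (ket U : M.State G) W = if W = U then 1 else 0 := by
  simp [ket]

omit [Group G] in
theorem opOfKets_ket (T : M.Config G → M.State G) (U : M.Config G) : opOfKets T (ket U) = T U := by
  rw [opOfKets_apply, Finset.sum_eq_single U]
  · simp [ket_apply]
  · intro W _ hW
    simp [ket_apply, hW]
  · simp

omit [Group G] in
theorem eq_sum_ket (ψ : M.State G) : ψ = ∑ U, ψ U • ket U := by
  ext W
  simp [ket_apply]

theorem vertexOp_apply (v : M.Vertex) (h : G) (ψ : M.State G) (W : M.Config G) :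
    vertexOp v h ψ W = ψ (gauge v h⁻¹ W) := by
  rw [vertexOp, opOfKets_apply]
  simp only [WithLp.ofLp_sum, Finset.sum_apply, PiLp.smul_apply, ket_apply, smul_eq_mul]
  rw [Finset.sum_eq_single (gauge v h⁻¹ W)]
  · simp [gauge_gauge_inv]
  · intro U _ hU
    rw [if_neg, mul_zero]
    rintro rfl
    exact hU (gauge_inv_gauge v h U).symm
  · simp

theorem faceOp_apply (s : M.Site) (f : G) (ψ : M.State G) (W : M.Config G) :
    faceOp s f ψ W = if holonomy s W = f then ψ W else 0 := by
  rw [faceOp, opOfKets_apply]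
  simp only [WithLp.ofLp_sum, Finset.sum_apply, PiLp.smul_apply]
  rw [Finset.sum_eq_single W]
  · split_ifs <;> simp [ket_apply]
  · intro U _ hU
    split_ifs <;> simp [ket_apply, hU.symm]
  · simp

theorem vertexOp_vertexProj (v : M.Vertex) (h : G) (ψ : M.State G) :
    vertexOp v h (vertexProj v ψ) = vertexProj v ψ := by
  simp only [vertexProj, LinearMap.smul_apply, map_smul, LinearMap.sum_apply, map_sum]
  congr 1
  refine Fintype.sum_equiv (Equiv.mulLeft h) _ _ fun x => ?_
  ext W
  simp only [vertexOp_apply, gauge_eq_gaugeAll, ← gaugeAll_mul, ← Pi.mulSingle_mul,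
    Equiv.coe_mulLeft, mul_inv_rev]

/-- The average over `G` absorbs every group element, so its fixed vectors are invariant under each
one. With `faceProj_eq_self_iff`, vacuum conditions become invariance and support conditions on the
coefficient function. -/
theorem vertexProj_eq_self_iff (v : M.Vertex) (ψ : M.State G) :
    vertexProj v ψ = ψ ↔ ∀ h W, ψ (gauge v h W) = ψ W := by
  constructor
  · intro h x W
    have := congrArg (fun φ : M.State G => φ W) (vertexOp_vertexProj v x⁻¹ ψ)
    simpa only [h, vertexOp_apply, inv_inv] using this
  · intro h
    have h' : ∀ x, vertexOp v x ψ = ψ := fun x => by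
      ext W
      rw [vertexOp_apply, h]
    simp only [vertexProj, LinearMap.smul_apply, LinearMap.sum_apply, h', Finset.sum_const,
      Finset.card_univ, ← Nat.cast_smul_eq_nsmul ℂ]
    rw [inv_smul_smul₀ (Nat.cast_ne_zero.mpr Fintype.card_ne_zero)]

theorem faceProj_eq_self_iff (s : M.Site) (ψ : M.State G) :
    faceProj s ψ = ψ ↔ ∀ W, ψ W ≠ 0 → holonomy s W = 1 := by
  constructor
  · intro h W hW
    by_contra hne
    rw [← h, faceProj, faceOp_apply, if_neg hne] at hW
    exact hW rfl
  · intro h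
    ext W
    rw [faceProj, faceOp_apply]
    split_ifs with hW
    · rfl
    · by_contra h0
      exact hW (h W (Ne.symm h0))

/-! ### Gauge invariance of two-particle states -/

omit [Fintype G] in
/-- A function on the configurations that is invariant under gauge transformations at all vertices
of a set is invariant under gauge transformations supported in this set. -/
theorem apply_gaugeAll_of_invariant {ψ : M.State G} {S : Set M.Vertex}
    (h : ∀ v ∈ S, ∀ x W, ψ (gauge v x W) = ψ W) (γ : M.Vertex → G) (hγ : ∀ v ∉ S, γ v = 1)
    (W : M.Config G) : ψ (gaugeAll γ W) = ψ W := by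
  let H : Subgroup (M.Vertex → G) :=
    { carrier := {γ | ∀ W, ψ (gaugeAll γ W) = ψ W}
      mul_mem' := fun {a b} ha hb W => by rw [gaugeAll_mul, ha, hb]
      one_mem' := fun W => by rw [gaugeAll_one]
      inv_mem' := fun {a} ha W => by
        rw [← ha (gaugeAll a⁻¹ W), ← gaugeAll_mul, mul_inv_cancel, gaugeAll_one] }
  refine Subgroup.pi_mem_of_mulSingle_mem (H := H) γ (fun v W => ?_) W
  by_cases hv : v ∈ S
  · rw [← gauge_eq_gaugeAll, h v hv]
  · rw [hγ v hv, Pi.mulSingle_one, gaugeAll_one]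

theorem apply_gaugeAll_of_mem_ribbonSpace {s₀ s₁ : M.Site} {ψ : M.State G}
    (hψ : ψ ∈ ribbonSpace G s₀ s₁) (γ : M.Vertex → G) (h₀ : γ (M.vertex s₀) = 1)
    (h₁ : γ (M.vertex s₁) = 1) (W : M.Config G) : ψ (gaugeAll γ W) = ψ W := by
  refine apply_gaugeAll_of_invariant (S := {v | v ≠ M.vertex s₀ ∧ v ≠ M.vertex s₁})
    (fun v hv => (vertexProj_eq_self_iff v ψ).mp (hψ.1 v hv.1 hv.2)) γ (fun v hv => ?_) W
  by_cases hv₀ : v = M.vertex s₀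
  · rw [hv₀, h₀]
  · rw [show v = M.vertex s₁ by by_contra h; exact hv ⟨hv₀, h⟩, h₁]

theorem apply_gaugeAll_congr {s₀ s₁ : M.Site} {ψ : M.State G}
    (hψ : ψ ∈ ribbonSpace G s₀ s₁) (γ δ : M.Vertex → G)
    (h₀ : γ (M.vertex s₀) = δ (M.vertex s₀)) (h₁ : γ (M.vertex s₁) = δ (M.vertex s₁))
    (W : M.Config G) : ψ (gaugeAll γ W) = ψ (gaugeAll δ W) := by
  rw [show γ = (γ * δ⁻¹) * δ by group, gaugeAll_mul]
  exact apply_gaugeAll_of_mem_ribbonSpace hψ _ (by simp [h₀]) (by simp [h₁]) _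

/-- On a sphere, transporting a gauge transformation that commutes with the holonomy from the
first to the second excited vertex of a state. -/
theorem apply_gauge_eq_apply_gauge {s₀ s₁ : M.Site} (hne : M.vertex s₀ ≠ M.vertex s₁)
    {ψ : M.State G} (hψ : ψ ∈ ribbonSpace G s₀ s₁) {W : M.Config G} {φ : M.Vertex → G}
    (hφ₀ : φ (M.vertex s₀) = 1)
    (hφ : ∀ d, φ (M.vertex d) * val W d * (φ (M.vertex (M.opp d)))⁻¹ ∈
        Subgroup.zpowers (holonomy s₀ W)) {x : G} (hx : Commute x (holonomy s₀ W)) :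
    ψ (gauge (M.vertex s₀) x⁻¹ W) =
      ψ (gauge (M.vertex s₁) ((φ (M.vertex s₁))⁻¹ * x * φ (M.vertex s₁)) W) := by
  -- This is the constant transformation `x` seen through the gauge `φ`. It fixes `W`, because `x`
  -- commutes with all powers of the holonomy.
  let γ : M.Vertex → G := fun v => (φ v)⁻¹ * x * φ v
  have hstab : gaugeAll γ W = W := by
    refine config_ext fun d => ?_
    obtain ⟨n, hn⟩ := hφ d
    have hc : Commute x (φ (M.vertex d) * val W d * (φ (M.vertex (M.opp d)))⁻¹) := by
      rw [← hn]
      exact hx.zpow_right n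
    rw [val_gaugeAll]
    have := hc.eq
    simp only [γ]
    calc _ = (φ (M.vertex d))⁻¹ * (x * (φ (M.vertex d) * val W d *
          (φ (M.vertex (M.opp d)))⁻¹)) * x⁻¹ * φ (M.vertex (M.opp d)) := by group
      _ = _ := by rw [this]; group
  rw [← congrArg (gauge (M.vertex s₀) x⁻¹) hstab, gauge_eq_gaugeAll, gauge_eq_gaugeAll,
    ← gaugeAll_mul]
  -- At the first vertex `x⁻¹` cancels `γ = x`; at the second only the value of `γ` remains.
  refine apply_gaugeAll_congr hψ _ _ ?_ ?_ W
  · simp [γ, hφ₀, Pi.mulSingle_eq_of_ne hne]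
  · simp [γ, Pi.mulSingle_eq_of_ne hne.symm]

end SurfaceMap

open SurfaceMap

namespace QuantumDouble

variable {G : Type*} [Group G] [Fintype G]

/-! ### The coefficients of the charge projectors -/

section Coefficients

variable (C : ConjClasses G) (r : G) (q : C.carrier → G) {V : Type*} [AddCommGroup V] [Module ℂ V]
  (π : Representation ℂ (Subgroup.centralizer {r}) V)

theorem proj_apply (x : G × G) :
    proj C r q π x = ((Module.finrank ℂ V : ℂ) / Nat.card (Subgroup.centralizer {r})) *
      ∑ c : C.carrier, ∑ n : Subgroup.centralizer {r},
        if ((c : G), q c * n * (q c)⁻¹) = x then LinearMap.trace ℂ V (π n⁻¹) else 0 := by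
  simp only [proj, Finsupp.smul_apply, Finsupp.finsetSum_apply, Finsupp.single_apply, smul_eq_mul]

theorem proj_apply_mem (c : C.carrier) (n : Subgroup.centralizer {r}) :
    proj C r q π ((c : G), q c * n * (q c)⁻¹) =
      ((Module.finrank ℂ V : ℂ) / Nat.card (Subgroup.centralizer {r})) *
        LinearMap.trace ℂ V (π n⁻¹) := by
  rw [proj_apply, Finset.sum_eq_single c, Finset.sum_eq_single n]
  · simp
  · intro m _ hm
    rw [if_neg]
    simpa [Prod.ext_iff] using hm
  · simp
  · intro d _ hd
    refine Finset.sum_eq_zero fun m _ => if_neg fun h => hd ?_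
    exact Subtype.ext (Prod.ext_iff.mp h).1
  · simp

theorem exists_of_proj_ne_zero {x : G × G} (h : proj C r q π x ≠ 0) :
    ∃ (c : C.carrier) (n : Subgroup.centralizer {r}), x = ((c : G), q c * n * (q c)⁻¹) := by
  rw [proj_apply] at h
  obtain ⟨c, -, hc⟩ := Finset.exists_ne_zero_of_sum_ne_zero (right_ne_zero_of_mul h)
  obtain ⟨n, -, hn⟩ := Finset.exists_ne_zero_of_sum_ne_zero hc
  refine ⟨c, n, ?_⟩
  by_contra hx
  exact hn (if_neg (Ne.symm hx))

variable {C r q} (hq : ∀ c : C.carrier, q c * r * (q c)⁻¹ = c)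
include hq

theorem commute_of_proj_ne_zero {c x : G} (h : proj C r q π (c, x) ≠ 0) : Commute x c := by
  obtain ⟨d, n, hd⟩ := exists_of_proj_ne_zero C r q π h
  obtain ⟨rfl, rfl⟩ := Prod.ext_iff.mp hd
  have hn : (r : G) * n = n * r := (Subgroup.mem_centralizer_iff.mp n.2) r rfl
  change _ * _ = _ * _
  simp only
  rw [← hq d]
  calc _ = q d * (n * r) * (q d)⁻¹ := by group
    _ = q d * (r * n) * (q d)⁻¹ := by rw [hn]
    _ = _ := by group

/-- Conjugation by `g` sends `d` to `e = g d g⁻¹` and conjugates `n` by `m = (q e)⁻¹ g (q d)`, which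
centralises `r`; the trace does not see this. -/
theorem proj_conj_of_ne_zero (g : G) {c x : G} (h : proj C r q π (c, x) ≠ 0) :
    proj C r q π (g * c * g⁻¹, g * x * g⁻¹) = proj C r q π (c, x) := by
  obtain ⟨d, n, hd⟩ := exists_of_proj_ne_zero C r q π h
  obtain ⟨rfl, rfl⟩ := Prod.ext_iff.mp hd
  simp only
  have hmem : g * d * g⁻¹ ∈ C.carrier := by
    have h1 : IsConj (d : G) (g * d * g⁻¹) := isConj_iff.mpr ⟨g, rfl⟩
    exact ConjClasses.mem_carrier_iff_mk_eq.mpr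
      ((ConjClasses.mk_eq_mk_iff_isConj.mpr h1).symm.trans
        (ConjClasses.mem_carrier_iff_mk_eq.mp d.2))
  set e : C.carrier := ⟨g * d * g⁻¹, hmem⟩ with he
  have hm : (q e)⁻¹ * g * q d ∈ Subgroup.centralizer {r} := by
    rw [Subgroup.mem_centralizer_iff]
    intro y hy
    rw [Set.mem_singleton_iff.mp hy]
    have h1 : q e * r * (q e)⁻¹ = g * (q d * r * (q d)⁻¹) * g⁻¹ := by rw [hq, hq]
    have h2 : r = (q e)⁻¹ * (q e * r * (q e)⁻¹) * q e := by group
    nth_rewrite 1 [h2]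
    rw [h1]
    group
  set m : Subgroup.centralizer {r} := ⟨_, hm⟩
  have hx : g * (q d * n * (q d)⁻¹) * g⁻¹ = q e * ((m * n * m⁻¹ : Subgroup.centralizer {r}) : G) *
      (q e)⁻¹ := by
    simp only [m, Subgroup.coe_mul, Subgroup.coe_inv]
    group
  rw [hx, show g * (d : G) * g⁻¹ = (e : G) from rfl, proj_apply_mem, proj_apply_mem]
  congr 1
  rw [show (m * n * m⁻¹)⁻¹ = m * n⁻¹ * m⁻¹ by group, map_mul, LinearMap.trace_mul_comm, ← map_mul]
  congr 2
  group

/-- The coefficients of the charge projectors are invariant under simultaneous conjugation. -/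
theorem proj_conj (g c x : G) :
    proj C r q π (g * c * g⁻¹, g * x * g⁻¹) = proj C r q π (c, x) := by
  by_cases h : proj C r q π (c, x) = 0
  · by_contra h'
    rw [h] at h'
    refine h' ?_
    rw [← proj_conj_of_ne_zero π hq g⁻¹ h', ← h]
    congr 2 <;> group
  · exact proj_conj_of_ne_zero π hq g h

end Coefficients

/-! ### The site actions in coordinates -/

variable {D : Type*} [Fintype D] {M : SurfaceMap D}

theorem leftAct_apply (s : M.Site) (y : QuantumDouble G) (ψ : M.State G) (W : M.Config G) :
    leftAct s y ψ W = ∑ x, y (holonomy s W, x) * ψ (gauge (M.vertex s) x⁻¹ W) := by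
  rw [leftAct, Finsupp.linearCombination_apply, Finsupp.sum_fintype _ _ (by simp)]
  simp only [LinearMap.sum_apply, LinearMap.smul_apply, LinearMap.comp_apply, WithLp.ofLp_sum,
    Finset.sum_apply, PiLp.smul_apply, faceOp_apply, vertexOp_apply, smul_eq_mul,
    Fintype.sum_prod_type, mul_ite, mul_zero]
  rw [Finset.sum_comm]
  simp

/-- The antipode inverts the group component, whence `x` in place of `x⁻¹`, and its face condition
fixes the first component as `x (holonomy s W)⁻¹ x⁻¹`. -/
theorem rightAct_apply (s : M.Site) (y : QuantumDouble G) (ψ : M.State G) (W : M.Config G) :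
    rightAct s ψ y W =
      ∑ x, y (x * (holonomy s W)⁻¹ * x⁻¹, x) * ψ (gauge (M.vertex s) x W) := by
  rw [rightAct, antipode, Finsupp.linearCombination_apply, Finsupp.sum_fintype _ _ (by simp),
    map_sum]
  simp only [map_smul, leftAct, Finsupp.linearCombination_single, one_smul,
    LinearMap.sum_apply, LinearMap.smul_apply, LinearMap.comp_apply, WithLp.ofLp_sum,
    Finset.sum_apply, PiLp.smul_apply, faceOp_apply, vertexOp_apply, smul_eq_mul,
    Fintype.sum_prod_type, mul_ite, mul_zero, inv_inv]
  rw [Finset.sum_comm]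
  refine Finset.sum_congr rfl fun x _ => ?_
  rw [Finset.sum_eq_single (x * (holonomy s W)⁻¹ * x⁻¹), if_pos (by group)]
  · intro c _ hc
    refine if_neg fun h => hc ?_
    rw [h]
    group
  · simp

theorem rightAct_proj_apply (s : M.Site) {C : ConjClasses G} {r : G} {q : C.carrier → G}
    (hq : ∀ c : C.carrier, q c * r * (q c)⁻¹ = c) {V : Type*} [AddCommGroup V] [Module ℂ V]
    (π : Representation ℂ (Subgroup.centralizer {r}) V) (ψ : M.State G) (W : M.Config G) :
    rightAct s ψ (proj C r q π) W =
      ∑ x, proj C r q π ((holonomy s W)⁻¹, x) * ψ (gauge (M.vertex s) x W) := by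
  rw [rightAct_apply]
  refine Finset.sum_congr rfl fun x _ => ?_
  rw [← proj_conj π hq x (holonomy s W)⁻¹ x, mul_inv_cancel_right]

/-- The charge at the first site of a two-particle state on the sphere is opposite to the charge
at the second site. -/
theorem leftAct_proj_eq_rightAct_proj (hM : M.IsSphere) {s₀ s₁ : M.Site}
    (hs : M.DisjointSites s₀ s₁) {C : ConjClasses G} {r : G} {q : C.carrier → G}
    (hq : ∀ c : C.carrier, q c * r * (q c)⁻¹ = c) {V : Type*} [AddCommGroup V] [Module ℂ V]
    (π : Representation ℂ (Subgroup.centralizer {r}) V) {ψ : M.State G}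
    (hψ : ψ ∈ ribbonSpace G s₀ s₁) :
    leftAct s₀ (proj C r q π) ψ = rightAct s₁ ψ (proj C r q π) := by
  ext W
  rw [leftAct_apply, rightAct_proj_apply s₁ hq]
  by_cases hW : ∀ s : M.Site, M.face s ≠ M.face s₀ → M.face s ≠ M.face s₁ → holonomy s W = 1
  · obtain ⟨φ, hφ₀, hφ⟩ := hM.exists_gauge_mem_zpowers (val W) (val_opp W) s₀ s₁ hW
    have hhol : holonomy s₁ W =
        (φ (M.vertex s₁))⁻¹ * (holonomy s₀ W)⁻¹ * φ (M.vertex s₁) :=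
      loopProd_eq_conj_inv (val W) (val_opp W) hs.2 hW φ hφ₀ hφ
    refine Fintype.sum_equiv (MulAut.conj (φ (M.vertex s₁))⁻¹).toEquiv _ _ fun x => ?_
    have hx : (MulAut.conj (φ (M.vertex s₁))⁻¹).toEquiv x =
        (φ (M.vertex s₁))⁻¹ * x * (φ (M.vertex s₁))⁻¹⁻¹ := rfl
    have hh : (holonomy s₁ W)⁻¹ =
        (φ (M.vertex s₁))⁻¹ * holonomy s₀ W * (φ (M.vertex s₁))⁻¹⁻¹ := by
      rw [hhol]
      group
    rw [hx, hh, proj_conj π hq]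
    by_cases h : proj C r q π (holonomy s₀ W, x) = 0
    · rw [h, zero_mul, zero_mul]
    · rw [apply_gauge_eq_apply_gauge hs.1 hψ hφ₀ hφ (commute_of_proj_ne_zero π hq h), inv_inv]
  -- A nontrivial holonomy off the two faces survives gauge transformations, so every term on both
  -- sides is zero.
  · push Not at hW
    obtain ⟨s, h₀, h₁, hne⟩ := hW
    have hz : ∀ v x, ψ (gauge v x W) = 0 := fun v x => by
      by_contra h
      exact hne ((holonomy_gauge_eq_one s v x W).mp
        ((faceProj_eq_self_iff s ψ).mp (hψ.2 s h₀ h₁) _ h))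
    simp [hz]

end QuantumDouble

namespace SurfaceMap

variable {D : Type*} {M : SurfaceMap D}

/-! ### The numbers of crossings of a ribbon -/

/-- The signed number of times that a triangle crosses a dart. -/
def Triangle.crossings : {s t : M.Site} → M.Triangle s t → D → ℤ
  | _, _, .direct _, _ => 0
  | _, _, .dual s, d => (if d = s then 1 else 0) - (if d = M.opp s then 1 else 0)

/-- The signed number of times that a ribbon crosses a dart. -/
def Ribbon.crossings : {s t : M.Site} → M.Ribbon s t → D → ℤ
  | _, _, .nil _, _ => 0
  | _, _, .snoc ξ τ, d => ξ.crossings d + τ.crossings d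

/-- The signed number of crossings of a triangle with an earlier part of the ribbon. -/
def Triangle.selfCrossings (n : D → ℤ) : {s t : M.Site} → M.Triangle s t → ℤ
  | _, _, .direct s => n s
  | _, _, .dual _ => 0

/-- The signed number of self-crossings of a ribbon. -/
def Ribbon.selfCrossings : {s t : M.Site} → M.Ribbon s t → ℤ
  | _, _, .nil _ => 0
  | _, _, .snoc ξ τ => ξ.selfCrossings + τ.selfCrossings ξ.crossings

/-- A dual triangle passes from the face of `s` to the face of `opp s`, where it is counted with
opposite signs. Along a ribbon the differences telescope. -/
theorem Triangle.sum_crossings [Fintype D] {s t : M.Site} (τ : M.Triangle s t) (f : M.Face) :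
    ∑ d with M.face d = f, τ.crossings d =
      (if M.face s = f then 1 else 0) - (if M.face t = f then 1 else 0) := by
  cases τ with
  | direct => simp [crossings, face_next]
  | dual =>
    simp only [crossings, Finset.sum_sub_distrib, Finset.sum_ite_eq', Finset.mem_filter,
      Finset.mem_univ, true_and, face_rot]

theorem Ribbon.sum_crossings [Fintype D] {s t : M.Site} (ξ : M.Ribbon s t) (f : M.Face) :
    ∑ d with M.face d = f, ξ.crossings d =
      (if M.face s = f then 1 else 0) - (if M.face t = f then 1 else 0) := by
  induction ξ with
  | nil => simp [crossings]
  | snoc ξ τ ih =>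
    simp only [crossings, Finset.sum_add_distrib, ih, τ.sum_crossings]
    ring

/-! ### The action of ribbon operators on basis states -/

variable {G : Type*} [Group G]

/-- The effect of a triangle operator on a configuration and an accumulated group element. -/
def Triangle.move (h : G) : {s t : M.Site} → M.Triangle s t → M.Config G × G → M.Config G × G
  | _, _, .direct s, p => (p.1, p.2 * val p.1 s)
  | _, _, .dual s, p => (edgeMul s (p.2⁻¹ * h * p.2) p.1, p.2)

/-- The configuration into which the ribbon operators `F^{h,g}` turn a given one, with the only
value of `g` for which the result is not zero. -/
def Ribbon.move (h : G) : {s t : M.Site} → M.Ribbon s t → M.Config G → M.Config G × G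
  | _, _, .nil _, U => (U, 1)
  | _, _, .snoc ξ τ, U => τ.move h (ξ.move h U)

theorem val_edgeMul (d : D) (k : G) (U : M.Config G) (e : D) :
    val (edgeMul d k U) e =
      if e = d then k * val U e else if e = M.opp d then val U e * k⁻¹ else val U e := by
  refine val_eq_of_arrow (w := fun e =>
    if e = d then k * val U e else if e = M.opp d then val U e * k⁻¹ else val U e)
    (fun e => ?_) (fun a => ?_) e
  · have h1 : M.opp e = d ↔ e = M.opp d :=
      ⟨fun h => by rw [← h, M.opp_opp], fun h => by rw [h, M.opp_opp]⟩
    have h2 : M.opp e = M.opp d ↔ e = d := M.opp.injective.eq_iff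
    have h3 := M.opp_ne d
    simp only [h1, h2, val_opp]
    by_cases he : e = d
    · subst he
      simp [h3.symm]
    · by_cases he' : e = M.opp d
      · subst he'
        simp [h3, val_opp]
      · simp [he, he']
  · simp only [val_arrow]
    rfl

theorem edgeMul_gaugeAll (d : D) (k : G) (γ : M.Vertex → G) (U : M.Config G) :
    edgeMul d (γ (M.vertex d) * k * (γ (M.vertex d))⁻¹) (gaugeAll γ U) =
      gaugeAll γ (edgeMul d k U) := by
  refine config_ext fun e => ?_
  rw [val_gaugeAll, val_edgeMul, val_edgeMul, val_gaugeAll]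
  split_ifs with h1 h2
  · subst h1
    group
  · subst h2
    rw [M.opp_opp]
    group
  · rfl

/-- The accumulated element is a transport from the starting vertex, where `γ` is trivial, so it
changes only at its far end; the conjugates of `h` used by dual triangles then transform
covariantly. -/
theorem Ribbon.move_gaugeAll {s t : M.Site} (ξ : M.Ribbon s t) (h : G) {γ : M.Vertex → G}
    (hγ : γ (M.vertex s) = 1) (U : M.Config G) :
    ξ.move h (gaugeAll γ U) =
      (gaugeAll γ (ξ.move h U).1, (ξ.move h U).2 * (γ (M.vertex t))⁻¹) := by
  induction ξ with
  | nil => simp [move, hγ]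
  | @snoc s _ ξ τ ih =>
    rw [move, move, ih]
    cases τ with
    | direct =>
      simp only [Triangle.move, val_gaugeAll, vertex_next]
      congr 1
      group
    | dual =>
      simp only [Triangle.move, vertex_rot]
      rw [← edgeMul_gaugeAll]
      congr 2
      group

theorem Ribbon.move_of_pure_gauge {s t : M.Site} (ξ : M.Ribbon s t) (h : G) {φ : M.Vertex → G}
    (hφ : φ (M.vertex s) = 1) {U : M.Config G}
    (hU : ∀ d, val U d = (φ (M.vertex d))⁻¹ * φ (M.vertex (M.opp d))) :
    (∀ d, val (ξ.move h U).1 d =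
      (φ (M.vertex d))⁻¹ * h ^ ξ.crossings d * φ (M.vertex (M.opp d))) ∧
    (ξ.move h U).2 = h ^ ξ.selfCrossings * φ (M.vertex t) := by
  induction ξ with
  | nil => simp [move, crossings, selfCrossings, hφ, hU]
  | @snoc s _ ξ τ ih =>
    obtain ⟨ih₁, ih₂⟩ := ih
    rw [move]
    cases τ with
    | direct =>
      refine ⟨fun d => ?_, ?_⟩
      · simp only [Triangle.move, crossings, Triangle.crossings, add_zero, ih₁]
      · simp only [Triangle.move, selfCrossings, Triangle.selfCrossings, ih₁, ih₂, vertex_next,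
          zpow_add]
        group
    | dual =>
      refine ⟨fun d => ?_, ?_⟩
      · simp only [Triangle.move, crossings, Triangle.crossings, val_edgeMul, ih₁, ih₂]
        -- Earlier self-crossings contribute powers of `h`, which commute with `h` and drop out of
        -- the conjugate.
        have hk : (h ^ ξ.selfCrossings * φ (M.vertex s))⁻¹ * h *
            (h ^ ξ.selfCrossings * φ (M.vertex s)) = (φ (M.vertex s))⁻¹ * h * φ (M.vertex s) := by
          group
        rw [hk]
        by_cases h1 : d = s
        · subst h1
          simp only [if_true, (M.opp_ne d).symm, if_false, sub_zero, zpow_add_one]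
          group
        · by_cases h2 : d = M.opp s
          · subst h2
            simp only [if_true, M.opp_ne s, if_false, zero_sub, zpow_add, M.opp_opp]
            group
          · simp only [h1, h2, if_false, sub_zero, add_zero]
      · simp only [Triangle.move, selfCrossings, Triangle.selfCrossings, add_zero, ih₂, vertex_rot]

theorem holonomy_of_val_eq_zpow [Fintype D] {W : M.Config G} {φ : M.Vertex → G} {h : G}
    {n : D → ℤ} (hW : ∀ d, val W d = (φ (M.vertex d))⁻¹ * h ^ n d * φ (M.vertex (M.opp d)))
    (s : M.Site) :
    holonomy s W =
      (φ (M.vertex s))⁻¹ * h ^ (∑ d with M.face d = M.face s, n d) * φ (M.vertex s) := by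
  have h1 := loopProd_conj (M := M) (fun d => h ^ n d) (fun v => (φ v)⁻¹) s
  have h2 := map_loopProd (M := M) (zpowersHom G h) (fun d => Multiplicative.ofAdd (n d)) s
  simp only [inv_inv] at h1
  simp only [zpowersHom_apply, toAdd_ofAdd, loopProd_eq_prod, ← ofAdd_sum] at h2
  rw [h2, ← h1]
  exact congrArg (fun w => M.loopProd w s) (funext hW)

/-- Flat configurations on the sphere are pure gauge. -/
theorem IsSphere.exists_pure_gauge [Finite D] (hM : M.IsSphere) (s₀ : M.Site) {W : M.Config G}
    (hW : ∀ s : M.Site, holonomy s W = 1) :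
    ∃ φ : M.Vertex → G, φ (M.vertex s₀) = 1 ∧
      ∀ d, val W d = (φ (M.vertex d))⁻¹ * φ (M.vertex (M.opp d)) := by
  obtain ⟨φ, hφ₀, hφ⟩ := hM.exists_gauge_mem_zpowers (val W) (val_opp W) s₀ s₀
    fun s _ _ => hW s
  refine ⟨φ, hφ₀, fun d => ?_⟩
  have h1 := hφ d
  rw [show M.loopProd (val W) s₀ = 1 from hW s₀, Subgroup.zpowers_one_eq_bot,
    Subgroup.mem_bot] at h1
  rw [mul_inv_eq_one] at h1
  rw [← h1]
  group

theorem val_gaugeAll_inv_one (φ : M.Vertex → G) (d : D) :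
    val (gaugeAll φ⁻¹ (1 : M.Config G)) d = (φ (M.vertex d))⁻¹ * φ (M.vertex (M.opp d)) := by
  have h1 : val (1 : M.Config G) d = 1 :=
    val_eq_of_arrow (w := fun _ => 1) (by simp) (fun _ => rfl) d
  rw [val_gaugeAll, h1]
  simp

variable [Fintype D] [Fintype G]

/-- In each convolution sum only the `f` equal to the accumulated group element survives. -/
theorem Ribbon.op_ket {s t : M.Site} (ξ : M.Ribbon s t) (h g : G) (U : M.Config G) :
    ξ.op h g (ket U) = if (ξ.move h U).2 = g then ket (ξ.move h U).1 else 0 := by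
  induction ξ generalizing g with
  | nil =>
    simp only [op, move, eq_comm (a := g)]
    split_ifs <;> rfl
  | snoc ξ τ ih =>
    simp only [op, move, LinearMap.sum_apply, LinearMap.comp_apply, ih, apply_ite, map_zero,
      Finset.sum_ite_eq, Finset.mem_univ, if_true]
    cases τ with
    | direct =>
      simp only [Triangle.op, Triangle.move, directOp, opOfKets_ket]
      simp only [eq_inv_mul_iff_mul_eq]
      split_ifs <;> rfl
    | dual =>
      simp only [Triangle.op, Triangle.move, inv_mul_eq_one]
      split_ifs
      · rw [dualOp, opOfKets_ket]
      · rfl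

/-! ### Vacuum states and Bell states -/

theorem bellState_apply {s t : M.Site} (ξ : M.Ribbon s t) (vac : M.State G) (W : M.Config G) :
    bellState ξ vac W = ∑ h : G, ∑ U, if ξ.move h U = (W, 1) then vac U else 0 := by
  rw [bellState]
  simp only [WithLp.ofLp_sum, Finset.sum_apply]
  refine Finset.sum_congr rfl fun h _ => ?_
  nth_rewrite 1 [eq_sum_ket vac]
  simp only [map_sum, map_smul, ξ.op_ket, WithLp.ofLp_sum, Finset.sum_apply, PiLp.smul_apply,
    smul_eq_mul]
  refine Finset.sum_congr rfl fun U _ => ?_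
  by_cases h2 : (ξ.move h U).2 = 1
  · by_cases h1 : (ξ.move h U).1 = W
    · simp [Prod.ext_iff, h1, h2, ket_apply]
    · simp [Prod.ext_iff, h1, h2, ket_apply, Ne.symm h1]
  · simp [Prod.ext_iff, h2]

theorem holonomy_eq_one_of_mem_vacuumSpace {vac : M.State G} (h : vac ∈ vacuumSpace M G)
    {W : M.Config G} (hW : vac W ≠ 0) (s : M.Site) : holonomy s W = 1 :=
  (faceProj_eq_self_iff s vac).mp (h.2 s) W hW

theorem apply_gaugeAll_of_mem_vacuumSpace {vac : M.State G} (h : vac ∈ vacuumSpace M G)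
    (γ : M.Vertex → G) (W : M.Config G) : vac (gaugeAll γ W) = vac W :=
  apply_gaugeAll_of_invariant (S := Set.univ)
    (fun v _ => (vertexProj_eq_self_iff v vac).mp (h.1 v)) γ (fun _ hv => absurd trivial hv) W

/-- On the sphere, a vacuum state is constant on its support. -/
theorem IsSphere.vacuum_apply (hM : M.IsSphere) (s₀ : M.Site) {vac : M.State G}
    (h : vac ∈ vacuumSpace M G) {W : M.Config G} (hW : vac W ≠ 0) :
    vac W = vac (1 : M.Config G) := by
  obtain ⟨φ, -, hφ⟩ := hM.exists_pure_gauge s₀ (holonomy_eq_one_of_mem_vacuumSpace h hW)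
  rw [← apply_gaugeAll_of_mem_vacuumSpace h φ⁻¹ 1]
  refine congrArg (fun U => vac U) ?_
  exact config_ext fun d => (hφ d).trans (val_gaugeAll_inv_one φ d).symm

theorem exists_of_bellState_ne_zero {s t : M.Site} {ξ : M.Ribbon s t} {vac : M.State G}
    {W : M.Config G} (h : bellState ξ vac W ≠ 0) :
    ∃ g U, ξ.move g U = (W, 1) ∧ vac U ≠ 0 := by
  rw [bellState_apply] at h
  obtain ⟨g, -, hg⟩ := Finset.exists_ne_zero_of_sum_ne_zero h
  obtain ⟨U, -, hU⟩ := Finset.exists_ne_zero_of_sum_ne_zero hg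
  exact ⟨g, U, by_contra fun h' => hU (if_neg h'), fun h' => hU (by simp [h'])⟩

/-- The configurations that occur in the Bell state of a ribbon. -/
theorem IsSphere.exists_val_eq_of_bellState_ne_zero (hM : M.IsSphere) {s t : M.Site}
    {ξ : M.Ribbon s t} {vac : M.State G} (hvac : vac ∈ vacuumSpace M G) {W : M.Config G}
    (h : bellState ξ vac W ≠ 0) :
    ∃ (g : G) (φ : M.Vertex → G), φ (M.vertex s) = 1 ∧
      (∀ d, val W d = (φ (M.vertex d))⁻¹ * g ^ ξ.crossings d * φ (M.vertex (M.opp d))) ∧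
      g ^ ξ.selfCrossings * φ (M.vertex t) = 1 := by
  obtain ⟨g, U, hU, hne⟩ := exists_of_bellState_ne_zero h
  obtain ⟨φ, hφ₀, hφ⟩ := hM.exists_pure_gauge s (holonomy_eq_one_of_mem_vacuumSpace hvac hne)
  obtain ⟨h₁, h₂⟩ := ξ.move_of_pure_gauge g hφ₀ hφ
  rw [hU] at h₁ h₂
  exact ⟨g, φ, hφ₀, h₁, h₂.symm⟩

theorem IsSphere.bellState_mem_ribbonSpace (hM : M.IsSphere) {s₀ s₁ : M.Site}
    (ξ : M.Ribbon s₀ s₁) {vac : M.State G} (hvac : vac ∈ vacuumSpace M G) :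
    bellState ξ vac ∈ ribbonSpace G s₀ s₁ := by
  refine ⟨fun v h₀ h₁ => (vertexProj_eq_self_iff _ _).mpr fun x W => ?_,
    fun s h₀ h₁ => (faceProj_eq_self_iff _ _).mpr fun W hW => ?_⟩
  · rw [bellState_apply, bellState_apply]
    refine Finset.sum_congr rfl fun g _ => ?_
    -- Being trivial at both end vertices, `γ` commutes with the ribbon move and keeps the
    -- accumulated element; it therefore only permutes the summands.
    let γ : M.Vertex → G := Pi.mulSingle v x
    have hinv : ∀ U : M.Config G, gaugeAll γ⁻¹ (gaugeAll γ U) = U := fun U => by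
      rw [← gaugeAll_mul, inv_mul_cancel, gaugeAll_one]
    have hinv' : ∀ U : M.Config G, gaugeAll γ (gaugeAll γ⁻¹ U) = U := fun U => by
      rw [← gaugeAll_mul, mul_inv_cancel, gaugeAll_one]
    refine (Fintype.sum_equiv ⟨gaugeAll γ, gaugeAll γ⁻¹, hinv, hinv'⟩ _ _ fun U => ?_).symm
    simp only [Equiv.coe_fn_mk]
    rw [ξ.move_gaugeAll g (Pi.mulSingle_eq_of_ne h₀.symm x), apply_gaugeAll_of_mem_vacuumSpace hvac,
      gauge_eq_gaugeAll, Pi.mulSingle_eq_of_ne h₁.symm, inv_one, mul_one]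
    refine if_congr ?_ rfl rfl
    rw [Prod.ext_iff, Prod.ext_iff]
    exact and_congr_left' ⟨fun h => congrArg (gaugeAll γ) h, fun h => by
      simpa only [γ, hinv] using congrArg (gaugeAll γ⁻¹) h⟩
  · obtain ⟨g, φ, -, hφ, -⟩ := hM.exists_val_eq_of_bellState_ne_zero hvac hW
    rw [holonomy_of_val_eq_zpow hφ, ξ.sum_crossings, if_neg h₀.symm, if_neg h₁.symm]
    simp

/-- A Bell state contains a configuration with given holonomy at the first site whose gauge
transforms at the first vertex, by elements that commute with the holonomy, do not occur. -/
theorem IsSphere.exists_bellState_ne_zero (hM : M.IsSphere) {s₀ s₁ : M.Site}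
    (hs : M.DisjointSites s₀ s₁) (ξ : M.Ribbon s₀ s₁) {vac : M.State G}
    (hvac : vac ∈ vacuumSpace M G) (hne : vac ≠ 0) (r : G) :
    ∃ W : M.Config G, holonomy s₀ W = r ∧ bellState ξ vac W ≠ 0 ∧
      ∀ x, Commute x r → x ≠ 1 → bellState ξ vac (gauge (M.vertex s₀) x⁻¹ W) = 0 := by
  -- The value at the end vertex makes the accumulated element equal to 1, so that `W` occurs in the
  -- Bell state.
  let φ : M.Vertex → G := Pi.mulSingle (M.vertex s₁) (r ^ ξ.selfCrossings)⁻¹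
  have hφ₀ : φ (M.vertex s₀) = 1 := Pi.mulSingle_eq_of_ne hs.1 _
  have hφ₁ : φ (M.vertex s₁) = (r ^ ξ.selfCrossings)⁻¹ := Pi.mulSingle_eq_same _ _
  set U : M.Config G := gaugeAll φ⁻¹ 1 with hU
  obtain ⟨hW, hW'⟩ := ξ.move_of_pure_gauge r hφ₀ (val_gaugeAll_inv_one φ)
  rw [← hU] at hW hW'
  set W := (ξ.move r U).1 with hWdef
  have hhol : ∀ {W' : M.Config G} {g : G} {φ' : M.Vertex → G}, φ' (M.vertex s₀) = 1 →
      (∀ d, val W' d = (φ' (M.vertex d))⁻¹ * g ^ ξ.crossings d * φ' (M.vertex (M.opp d))) →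
      holonomy s₀ W' = g := by
    intro W' g φ' h₀ h
    rw [holonomy_of_val_eq_zpow h, ξ.sum_crossings, if_pos rfl, if_neg hs.2.symm, h₀]
    simp
  have hmove : ξ.move r U = (W, 1) := Prod.ext rfl (by rw [hW', hφ₁, mul_inv_cancel])
  have hκ : vac (1 : M.Config G) ≠ 0 := by
    obtain ⟨W₀, hW₀⟩ : ∃ W₀, vac W₀ ≠ 0 := by
      by_contra! h
      exact hne (by ext W₀; exact h W₀)
    rwa [← hM.vacuum_apply s₀ hvac hW₀]
  refine ⟨W, hhol hφ₀ hW, ?_, fun x hx hx1 => ?_⟩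
  -- All nonzero summands equal the same number `vac 1`, so they cannot cancel.
  · have hterm : ∀ g U', (if ξ.move g U' = (W, 1) then vac U' else 0) =
        if ξ.move g U' = (W, 1) ∧ vac U' ≠ 0 then vac (1 : M.Config G) else 0 := by
      intro g U'
      by_cases h0 : vac U' = 0
      · simp [h0]
      · simp [hκ, hM.vacuum_apply s₀ hvac h0]
    rw [bellState_apply, ← Fintype.sum_prod_type'
      (f := fun g U' => if ξ.move g U' = (W, 1) then vac U' else 0)]
    simp only [hterm]
    rw [← Finset.sum_filter, Finset.sum_const, nsmul_eq_mul]
    refine mul_ne_zero (Nat.cast_ne_zero.mpr (Finset.card_ne_zero.mpr ⟨(r, U), ?_⟩)) hκ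
    simp only [Finset.mem_filter, Finset.mem_univ, true_and]
    refine ⟨hmove, ?_⟩
    rwa [hU, apply_gaugeAll_of_mem_vacuumSpace hvac]
  · by_contra hB
    obtain ⟨g, φ', hφ'₀, hφ', hφ'₁⟩ := hM.exists_val_eq_of_bellState_ne_zero hvac hB
    have hg : g = r := by
      rw [← hhol hφ'₀ hφ', holonomy_gauge, hhol hφ₀ hW, inv_inv, hx.inv_left.eq]
      group
    subst hg
    let γ : M.Vertex → G := Pi.mulSingle (M.vertex s₀) x⁻¹
    -- `η` compares the two gauges. Along edges it changes by conjugation only, and it is 1 at the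
    -- second vertex because both accumulated elements are 1. Hence it is 1 at the first vertex too,
    -- where it equals `x⁻¹`.
    let η : M.Vertex → G := fun v => φ' v * γ v * (φ v)⁻¹
    have hη : ∀ d, η (M.vertex d) =
        g ^ ξ.crossings d * η (M.vertex (M.opp d)) * (g ^ ξ.crossings d)⁻¹ := by
      intro d
      have h1 := hφ' d
      rw [gauge_eq_gaugeAll, val_gaugeAll, hW] at h1
      change γ _ * _ * (γ _)⁻¹ = _ at h1
      calc η (M.vertex d) = φ' (M.vertex d) * (γ (M.vertex d) *
            ((φ (M.vertex d))⁻¹ * g ^ ξ.crossings d * φ (M.vertex (M.opp d))) *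
            (γ (M.vertex (M.opp d)))⁻¹) * γ (M.vertex (M.opp d)) *
            (φ (M.vertex (M.opp d)))⁻¹ * (g ^ ξ.crossings d)⁻¹ := by
            simp only [η]; group
        _ = _ := by rw [h1]; simp only [η]; group
    have h1 : η (M.vertex s₁) = 1 := by
      simp only [η, γ, Pi.mulSingle_eq_of_ne hs.1.symm, hφ₁, mul_one, inv_inv]
      rw [eq_inv_of_mul_eq_one_right hφ'₁, inv_mul_cancel]
    have h0 := hM.forall_dart (fun d => η (M.vertex d) = 1) (fun d => by rw [vertex_rot])
      (fun d => by rw [hη d, conj_eq_one_iff]) h1 s₀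
    simp only [η, γ, hφ₀, hφ'₀, Pi.mulSingle_eq_same, one_mul, inv_one, mul_one, inv_eq_one] at h0
    exact hx1 h0

end SurfaceMap

/-! ### Nonvanishing charge of the Bell states -/

open SurfaceMap QuantumDouble

theorem nontrivial_of_isIrreducible {k G V : Type*} [Monoid G] [Field k] [AddCommGroup V]
    [Module k V] {π : Representation k G V} (hπ : π.IsIrreducible) : Nontrivial V := by
  by_contra h
  rw [not_nontrivial_iff_subsingleton] at h
  obtain ⟨a, b, hab⟩ := hπ.toNontrivial
  refine hab (SetLike.ext fun x => ?_)
  rw [Subsingleton.elim x 0]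
  exact iff_of_true a.toSubmodule.zero_mem b.toSubmodule.zero_mem

/-- The charge projectors do not annihilate the Bell states. -/
theorem leftAct_proj_bellState_ne_zero {G : Type*} [Group G] [Fintype G] {D : Type*} [Fintype D]
    {M : SurfaceMap D} (hM : M.IsSphere) {s₀ s₁ : M.Site} (hs : M.DisjointSites s₀ s₁)
    {C : ConjClasses G} {r : G} (hr : r ∈ C.carrier) {q : C.carrier → G}
    (hq : ∀ c : C.carrier, q c * r * (q c)⁻¹ = c)
    {V : Type*} [AddCommGroup V] [Module ℂ V] [FiniteDimensional ℂ V] [Nontrivial V]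
    (π : Representation ℂ (Subgroup.centralizer {r}) V) {vac : M.State G}
    (hvac : vac ∈ vacuumSpace M G) (hne : vac ≠ 0) (ξ : M.Ribbon s₀ s₁) :
    leftAct s₀ (proj C r q π) (bellState ξ vac) ≠ 0 := by
  obtain ⟨W, hhol, hW, hW'⟩ := hM.exists_bellState_ne_zero hs ξ hvac hne r
  intro h0
  have h1 : leftAct s₀ (proj C r q π) (bellState ξ vac) W = 0 := by rw [h0]; rfl
  -- Only `x = 1` contributes at `W`, with coefficient `(dim V)² / |C_G|`.
  rw [leftAct_apply, hhol, Finset.sum_eq_single 1] at h1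
  · rw [inv_one, gauge_eq_gaugeAll, Pi.mulSingle_one, gaugeAll_one] at h1
    have h2 := proj_apply_mem C r q π ⟨r, hr⟩ 1
    rw [Subgroup.coe_one, mul_one, mul_inv_cancel] at h2
    rw [h2, inv_one, map_one, LinearMap.trace_one] at h1
    have h3 : (Module.finrank ℂ V : ℂ) ≠ 0 := Nat.cast_ne_zero.mpr Module.finrank_pos.ne'
    have h4 : (Nat.card (Subgroup.centralizer {r}) : ℂ) ≠ 0 :=
      Nat.cast_ne_zero.mpr Nat.card_pos.ne'
    exact mul_ne_zero (mul_ne_zero (div_ne_zero h3 h4) h3) hW h1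
  · intro x _ hx
    by_cases h2 : proj C r q π (r, x) = 0
    · rw [h2, zero_mul]
    · rw [hW' x (commute_of_proj_ne_zero π hq h2) hx, mul_zero]
  · simp

end Kitaev

end

open Kitaev Kitaev.SurfaceMap Kitaev.QuantumDouble in
theorem mainTheorem11 {G : Type*} [Group G] [Fintype G] {D : Type*} [Fintype D]
    (M : SurfaceMap D) (hM : M.IsSphere)
    (s₀ s₁ : M.Site) (hs : M.DisjointSites s₀ s₁)
    (C : ConjClasses G) (r : G) (hr : r ∈ C.carrier)
    (q : C.carrier → G) (hq : ∀ c : C.carrier, q c * r * (q c)⁻¹ = c)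
    {V : Type*} [AddCommGroup V] [Module ℂ V] [FiniteDimensional ℂ V]
    (π : Representation ℂ (Subgroup.centralizer {r}) V) (hπ : π.IsIrreducible) :
    (∀ ψ ∈ ribbonSpace G s₀ s₁,
      leftAct s₀ (proj C r q π) ψ = rightAct s₁ ψ (proj C r q π) ∧
      (leftAct s₀ (proj C r q π) ψ ≠ 0 ↔ rightAct s₁ ψ (proj C r q π) ≠ 0)) ∧
    (∀ vac ∈ vacuumSpace M G, vac ≠ 0 → ∀ ξ : M.Ribbon s₀ s₁,
      bellState ξ vac ∈ ribbonSpace G s₀ s₁ ∧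
      leftAct s₀ (proj C r q π) (bellState ξ vac) =
        rightAct s₁ (bellState ξ vac) (proj C r q π) ∧
      leftAct s₀ (proj C r q π) (bellState ξ vac) ≠ 0) := by
  have := nontrivial_of_isIrreducible hπ
  have key : ∀ ψ ∈ ribbonSpace G s₀ s₁,
      leftAct s₀ (proj C r q π) ψ = rightAct s₁ ψ (proj C r q π) :=
    fun ψ hψ => leftAct_proj_eq_rightAct_proj hM hs hq π hψ
  refine ⟨fun ψ hψ => ⟨key ψ hψ, by rw [key ψ hψ]⟩, fun vac hvac hne ξ => ?_⟩
  have hmem := hM.bellState_mem_ribbonSpace ξ hvac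
  exact ⟨hmem, key _ hmem, leftAct_proj_bellState_ne_zero hM hs hr hq π hvac hne ξ⟩
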